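/- Let $d\ge 1$, let $A,\bar A\in\mathbb R^{n\times n}$, $B,\bar B\in\mathbb R^{n\times m}$, and let $(w_k)_{k\ge0}$ be scalar white noise on a probability space: with $\mathcal F_k=\sigma(w_0,\dots,w_k)$ and $\mathcal F_{-1}$ trivial, $w_k\in L^2$, $\mathsf E[w_k\mid\mathcal F_{k-1}]=0$ and $\mathsf E[w_k^2\mid\mathcal F_{k-1}]=1$ (for instance, independent variables with zero mean and unit variance). Consider $$x_{k+1}=(A+w_k\bar A)x_k+(B+w_k\bar B)u_{k-d},\qquad k\ge 0,$$ with deterministic initial data $x_0,u_{-d},\dots,u_{-1}$. A gain $K\in\mathbb R^{m\times n}$ is called stabilizing if, for all initial data, the predictor feedback $u_{k-d}=-K\,\mathsf E[x_k\mid\mathcal F_{k-d-1}]$, $k\ge d$, gives $\lim_{k\to\infty}\mathsf E[x_k'x_k]=0$. Let $Q\ge0$ and $R>0$ be symmetric, and assume that $(A,\bar A|Q^{1/2})$ is exactly observable: if the solution of $x_{k+1}=(A+w_k\bar A)x_k$ with deterministic $x_0$ satisfies $Q^{1/2}x_k=0$ a.s. for all $k\ge0$, then $x_0=0$. Let $K_0$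 be stabilizing. Then there are unique sequences $(K_j)_{j\ge 0}$, starting from $K_0$, and $(P_j^0,\dots,P_j^d)_{j\ge0}$ such that, for every $j\ge0$, the matrices $P_j^0,\dots,P_j^d$ are positive definite and $$P_j^{i-1}=A'P_j^iA+\bar A'P_j^0\bar A+Q,\quad i=1,\dots,d,$$ $$P_j^d=(A-BK_j)'P_j^d(A-BK_j)+(\bar A-\bar BK_j)'P_j^0(\bar A-\bar BK_j)+K_j'RK_j+Q,$$ $$K_{j+1}=(R+B'P_j^dB+\bar B'P_j^0\bar B)^{-1}(B'P_j^dA+\bar B'P_j^0\bar A).$$ Moreover: 1. every $K_j$ is stabilizing; 2. $0<P_{j+1}^i\le P_j^i$ for all $j\ge0$ and $i=0,\dots,d$; 3. $\lim_{j\to\infty}P_j^i=P^i$ for $i=0,\dots,d$ and $\lim_{j\to\infty}K_j=K$, where $(P^0,\dots,P^d,K)$ is the unique solution with all $P^i$ positive definite of the Riccati-type equations $$P^{i-1}=A'P^iA+\bar A'P^0\bar A+Q,\quad i=1,\dots,d,$$ $$P^d=(A-BK)'P^d(A-BK)+(\bar A-\bar BK)'P^0(\bar A-\bar BK)+K'RK+Q,$$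 $$K=(R+B'P^dB+\bar B'P^0\bar B)^{-1}(B'P^dA+\bar B'P^0\bar A).$$ The gain $K$ is optimal: it is stabilizing, and for all initial data its predictor feedback has finite cost $J=\mathsf E\sum_{k=0}^\infty(x_k'Qx_k+u_{k-d}'Ru_{k-d})$, which is minimal among all controls such that $u_{k-d}$ is $\mathcal F_{k-d-1}$-measurable for $k\ge d$ and $\mathsf E[x_k'x_k]\to0$. -/

import Mathlib

open MeasureTheory Filter Topology
open scoped Matrix MatrixOrder

noncomputable section

/-- Coefficients of the multiplicative-noise system
`x_{k+1} = (A + w_k Abar) x_k + (B + w_k Bbar) u_{k-d}`. -/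
structure NoisySystem (n m : ℕ) where
  A : Matrix (Fin n) (Fin n) ℝ
  Abar : Matrix (Fin n) (Fin n) ℝ
  B : Matrix (Fin n) (Fin m) ℝ
  Bbar : Matrix (Fin n) (Fin m) ℝ

/-- `pastSigma w k = σ(w_0, …, w_{k-1})`, which is `ℱ_{k-1}` for the natural filtration of the noise;
`pastSigma w 0` is the trivial σ-algebra. -/
@[reducible] def pastSigma {Ω : Type*} (w : ℕ → Ω → ℝ) (k : ℕ) : MeasurableSpace Ω :=
  ⨆ i : Fin k, MeasurableSpace.comap (w i) inferInstance

/-- Scalar white noise: conditionally on the past, zero mean and unit variance. Independent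
variables with zero mean and unit variance are the main example. -/
structure IsWhiteNoise {Ω : Type*} [MeasurableSpace Ω] (μ : Measure Ω) (w : ℕ → Ω → ℝ) : Prop where
  measurable : ∀ k, Measurable (w k)
  memLp : ∀ k, MemLp (w k) 2 μ
  mean_zero : ∀ k, μ[w k | pastSigma w k] =ᵐ[μ] fun _ => 0
  unit_variance : ∀ k, μ[fun ω => w k ω ^ 2 | pastSigma w k] =ᵐ[μ] fun _ => 1

namespace NoisySystem

variable {n m : ℕ} {Ω : Type*}

/-- One step of the dynamics, with noise value `r`, state `x` and acting input `v`. -/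
def step (S : NoisySystem n m) (r : ℝ) (x : Fin n → ℝ) (v : Fin m → ℝ) : Fin n → ℝ :=
  (S.A + r • S.Abar) *ᵥ x + (S.B + r • S.Bbar) *ᵥ v

/-- The state started at `x0` when `v k` is the input acting at time `k`, that is `v k = u_{k-d}`. -/
def state (S : NoisySystem n m) (w : ℕ → Ω → ℝ) (x0 : Fin n → ℝ) (v : ℕ → Ω → Fin m → ℝ) :
    ℕ → Ω → Fin n → ℝ
  | 0 => fun _ => x0
  | k + 1 => fun ω => S.step (w k ω) (state S w x0 v k ω) (v k ω)

variable [MeasurableSpace Ω]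

/-- The input acting at time `k` (that is, `u_{k-d}`) under predictor feedback, given the state `x`
at time `k`: the initial datum `u0 k = u_{k-d}` for `k < d`, and `-K E[x_k | ℱ_{k-d-1}]` for
`k ≥ d`. -/
def predictorInput {d : ℕ} (μ : Measure Ω) (w : ℕ → Ω → ℝ) (K : Matrix (Fin m) (Fin n) ℝ)
    (u0 : Fin d → Fin m → ℝ) (k : ℕ) (x : Ω → Fin n → ℝ) : Ω → Fin m → ℝ :=
  fun ω => if h : k < d then u0 ⟨k, h⟩ else -(K *ᵥ (μ[x | pastSigma w (k - d)]) ω)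

/-- The closed-loop state under predictor feedback with gain `K` and initial data
`x_0 = x0`, `u_{k-d} = u0 k` for `k < d`. -/
def closedLoop (S : NoisySystem n m) {d : ℕ} (μ : Measure Ω) (w : ℕ → Ω → ℝ)
    (K : Matrix (Fin m) (Fin n) ℝ) (x0 : Fin n → ℝ) (u0 : Fin d → Fin m → ℝ) :
    ℕ → Ω → Fin n → ℝ
  | 0 => fun _ => x0
  | k + 1 => fun ω => S.step (w k ω) (closedLoop S μ w K x0 u0 k ω)
      (predictorInput μ w K u0 k (closedLoop S μ w K x0 u0 k) ω)

/-- The input acting along the closed loop. -/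
def closedLoopInput (S : NoisySystem n m) {d : ℕ} (μ : Measure Ω) (w : ℕ → Ω → ℝ)
    (K : Matrix (Fin m) (Fin n) ℝ) (x0 : Fin n → ℝ) (u0 : Fin d → Fin m → ℝ) :
    ℕ → Ω → Fin m → ℝ :=
  fun k => predictorInput μ w K u0 k (S.closedLoop μ w K x0 u0 k)

/-- `E[x_k' x_k] → 0`. -/
def MeanSquareStable (μ : Measure Ω) (x : ℕ → Ω → Fin n → ℝ) : Prop :=
  Tendsto (fun k => ∫⁻ ω, ENNReal.ofReal (x k ω ⬝ᵥ x k ω) ∂μ) atTop (𝓝 0)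

/-- The predictor-feedback gain `K` is stabilizing for input delay `d`. -/
def IsStabilizing (S : NoisySystem n m) (d : ℕ) (μ : Measure Ω) (w : ℕ → Ω → ℝ)
    (K : Matrix (Fin m) (Fin n) ℝ) : Prop :=
  ∀ (x0 : Fin n → ℝ) (u0 : Fin d → Fin m → ℝ), MeanSquareStable μ (S.closedLoop μ w K x0 u0)

/-- Exact observability of `(A, Abar | Q^{1/2})`: the uncontrolled system has no nonzero initial
state for which the output `Q^{1/2} x_k` vanishes almost surely at all times. -/
def ExactlyObservable (S : NoisySystem n m) (μ : Measure Ω) (w : ℕ → Ω → ℝ)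
    (Q : Matrix (Fin n) (Fin n) ℝ) : Prop :=
  ∀ x0 : Fin n → ℝ,
    (∀ k, ∀ᵐ ω ∂μ, CFC.sqrt Q *ᵥ S.state w x0 (fun _ _ => 0) k ω = 0) → x0 = 0

/-- `E ∑_k (x_k' Q x_k + v_k' R v_k)`, with `v_k = u_{k-d}`, as an extended nonnegative number. -/
def cost (μ : Measure Ω) (Q : Matrix (Fin n) (Fin n) ℝ) (R : Matrix (Fin m) (Fin m) ℝ)
    (x : ℕ → Ω → Fin n → ℝ) (v : ℕ → Ω → Fin m → ℝ) : ENNReal :=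
  ∫⁻ ω, ∑' k, ENNReal.ofReal (x k ω ⬝ᵥ Q *ᵥ x k ω + v k ω ⬝ᵥ R *ᵥ v k ω) ∂μ

/-- Admissible inputs for given initial data: `u_{k-d}` is the initial datum for `k < d` and
`ℱ_{k-d-1}`-measurable (up to null sets) for `k ≥ d`, and the state is mean-square stable. -/
structure IsAdmissible (S : NoisySystem n m) {d : ℕ} (μ : Measure Ω) (w : ℕ → Ω → ℝ)
    (x0 : Fin n → ℝ) (u0 : Fin d → Fin m → ℝ) (v : ℕ → Ω → Fin m → ℝ) : Prop where
  initial : ∀ k : Fin d, v k = fun _ => u0 k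
  adapted : ∀ k, d ≤ k → AEStronglyMeasurable[pastSigma w (k - d)] (v k) μ
  stable : MeanSquareStable μ (S.state w x0 v)

/-- `K` is an optimal gain: it is stabilizing and, for all initial data, predictor feedback with
gain `K` has finite cost, minimal among all admissible inputs. -/
def IsOptimalGain (S : NoisySystem n m) (d : ℕ) (μ : Measure Ω) (w : ℕ → Ω → ℝ)
    (Q : Matrix (Fin n) (Fin n) ℝ) (R : Matrix (Fin m) (Fin m) ℝ)
    (K : Matrix (Fin m) (Fin n) ℝ) : Prop :=
  S.IsStabilizing d μ w K ∧
  ∀ (x0 : Fin n → ℝ) (u0 : Fin d → Fin m → ℝ),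
    cost μ Q R (S.closedLoop μ w K x0 u0) (S.closedLoopInput μ w K x0 u0) ≠ ⊤ ∧
    ∀ v, S.IsAdmissible μ w x0 u0 v →
      cost μ Q R (S.closedLoop μ w K x0 u0) (S.closedLoopInput μ w K x0 u0) ≤
        cost μ Q R (S.state w x0 v) v

/-- The coupled Lyapunov-type equations for `P 0, …, P d` with gain `K`. -/
def LyapunovEqs (S : NoisySystem n m) {d : ℕ} (Q : Matrix (Fin n) (Fin n) ℝ)
    (R : Matrix (Fin m) (Fin m) ℝ) (K : Matrix (Fin m) (Fin n) ℝ)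
    (P : Fin (d + 1) → Matrix (Fin n) (Fin n) ℝ) : Prop :=
  (∀ i : Fin d, P i.castSucc = S.Aᵀ * P i.succ * S.A + S.Abarᵀ * P 0 * S.Abar + Q) ∧
  P (Fin.last d) = (S.A - S.B * K)ᵀ * P (Fin.last d) * (S.A - S.B * K)
    + (S.Abar - S.Bbar * K)ᵀ * P 0 * (S.Abar - S.Bbar * K) + Kᵀ * R * K + Q

/-- `(R + B' P^d B + Bbar' P^0 Bbar)⁻¹ (B' P^d A + Bbar' P^0 Abar)`. -/
def gain (S : NoisySystem n m) {d : ℕ} (R : Matrix (Fin m) (Fin m) ℝ)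
    (P : Fin (d + 1) → Matrix (Fin n) (Fin n) ℝ) : Matrix (Fin m) (Fin n) ℝ :=
  (R + S.Bᵀ * P (Fin.last d) * S.B + S.Bbarᵀ * P 0 * S.Bbar)⁻¹ *
    (S.Bᵀ * P (Fin.last d) * S.A + S.Bbarᵀ * P 0 * S.Abar)

/-- The sequences produced by policy iteration from `K0`. -/
structure IsPolicyIteration (S : NoisySystem n m) {d : ℕ} (Q : Matrix (Fin n) (Fin n) ℝ)
    (R : Matrix (Fin m) (Fin m) ℝ) (K0 : Matrix (Fin m) (Fin n) ℝ)
    (K : ℕ → Matrix (Fin m) (Fin n) ℝ)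
    (P : ℕ → Fin (d + 1) → Matrix (Fin n) (Fin n) ℝ) : Prop where
  init : K 0 = K0
  posDef : ∀ j i, (P j i).PosDef
  lyapunov : ∀ j, S.LyapunovEqs Q R (K j) (P j)
  update : ∀ j, K (j + 1) = S.gain R (P j)

/-- `P 0, …, P d` is a positive definite solution of the Riccati-type equations, with gain `K`. -/
structure IsRiccatiSolution (S : NoisySystem n m) {d : ℕ} (Q : Matrix (Fin n) (Fin n) ℝ)
    (R : Matrix (Fin m) (Fin m) ℝ) (K : Matrix (Fin m) (Fin n) ℝ)
    (P : Fin (d + 1) → Matrix (Fin n) (Fin n) ℝ) : Prop where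
  posDef : ∀ i, (P i).PosDef
  lyapunov : S.LyapunovEqs Q R K P
  gain_eq : K = S.gain R P

end NoisySystem

end

/-! The problem reduces to one positive linear operator on families of matrices. Split `x_k` into
the innovations `E[x_k | ℱ_{k-i-1}] - E[x_k | ℱ_{k-i-2}]`, `i < d`, and the predictor `E[x_k |
ℱ_{k-d-1}]`. These pieces are orthogonal. One step of the dynamics ages each innovation by `A`,
creates a new innovation from the noise term, and lets the input act only through the predictor and
the new innovation. Weighting innovation `i` by `P^i` and the predictor by `P^d` gives `energy`, and
under predictor feedback a step of time replaces `P` by `lyapOp d K P` (`energy_succ_feedback`).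
Hence `K` is stabilizing exactly when all orbits of `lyapOp d K` tend to zero
(`isStabilizing_of_contracting`, `contracting_of_isStabilizing`), and policy iteration becomes
deterministic.

Write `L_K` for this operator and `C_K` for `runCost`. Exact observability makes every nonnegative
`P` with `L_K P + C_K ≤ P` positive definite (`GramObservable.posDef`), and then the existence of
one such `P` forces contraction (`contracting_of_supersolution`). Completing the square shows that
the updated gain minimizes `L_K P + C_K` over `K` (`lyapOp_gain_le`). So `P_j` is a supersolution
for `K_{j+1}`, which is therefore contracting, and comparison gives `P_{j+1} ≤ P_j`. The decreasing
sequence converges to a Riccati solution, and comparison in both directions gives uniqueness.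

For optimality the same completed square is summed over time (`sum_stageCost`): cost up to `N` plus
terminal energy equals `x_0' P^d x_0` plus nonnegative deviation costs. The first `d` deviations are
fixed by the initial data, the later ones vanish for the optimal feedback, and stability removes the
terminal energy. -/

/-! ### Quadratic forms and the order on symmetric matrices -/

section QuadraticForms

variable {ν : Type*} [Fintype ν]

theorem Matrix.posSemidef_iff_real {P : Matrix ν ν ℝ} :
    P.PosSemidef ↔ Pᵀ = P ∧ ∀ x, 0 ≤ x ⬝ᵥ P *ᵥ x := by
  simpa [Matrix.IsHermitian] using Matrix.posSemidef_iff_dotProduct_mulVec (M := P)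

theorem Matrix.PosSemidef.quadForm_nonneg {P : Matrix ν ν ℝ} (h : P.PosSemidef) (x : ν → ℝ) :
    0 ≤ x ⬝ᵥ P *ᵥ x :=
  (Matrix.posSemidef_iff_real.1 h).2 x

theorem Matrix.PosSemidef.transpose_eq {P : Matrix ν ν ℝ} (h : P.PosSemidef) : Pᵀ = P :=
  (Matrix.posSemidef_iff_real.1 h).1

theorem Matrix.posDef_of_ker {P : Matrix ν ν ℝ} (h : P.PosSemidef)
    (hker : ∀ x, x ⬝ᵥ P *ᵥ x = 0 → x = 0) : P.PosDef := by
  refine Matrix.PosDef.of_dotProduct_mulVec_pos h.isHermitian fun x hx => ?_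
  have h0 := h.quadForm_nonneg x
  exact lt_of_le_of_ne (by simpa using h0) fun h1 => hx (hker x (by simpa using h1.symm))

theorem Matrix.PosDef.eq_zero_of_quadForm {P : Matrix ν ν ℝ} (h : P.PosDef) {x : ν → ℝ}
    (hx : x ⬝ᵥ P *ᵥ x = 0) : x = 0 := by
  by_contra hne
  have := h.dotProduct_mulVec_pos hne
  simp [hx] at this

theorem Matrix.quadForm_congr_mul {κ ι : Type*} [Fintype κ] [Fintype ι] (F : Matrix ν κ ℝ)
    (P : Matrix ν ν ℝ) (G : Matrix ν ι ℝ) (x : κ → ℝ) (y : ι → ℝ) :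
    x ⬝ᵥ (Fᵀ * P * G) *ᵥ y = (F *ᵥ x) ⬝ᵥ P *ᵥ (G *ᵥ y) := by
  rw [← Matrix.mulVec_mulVec, ← Matrix.mulVec_mulVec, Matrix.dotProduct_mulVec,
    Matrix.vecMul_transpose]

theorem Matrix.PosSemidef.congr_mul {κ : Type*} [Fintype κ] {P : Matrix ν ν ℝ} (h : P.PosSemidef)
    (F : Matrix ν κ ℝ) : (Fᵀ * P * F).PosSemidef := by
  simpa using h.conjTranspose_mul_mul_same F

/-- A symmetric matrix is recovered from its quadratic form by polarization. -/
theorem Matrix.apply_eq_polarization [DecidableEq ν] {P : Matrix ν ν ℝ} (h : Pᵀ = P) (i j : ν) :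
    P i j = ((Pi.single i 1 + Pi.single j 1) ⬝ᵥ P *ᵥ (Pi.single i 1 + Pi.single j 1)
      - (Pi.single i 1 - Pi.single j 1) ⬝ᵥ P *ᵥ (Pi.single i 1 - Pi.single j 1)) / 4 := by
  have hs : P j i = P i j := congrFun (congrFun h i) j
  simp only [Matrix.mulVec_add, Matrix.mulVec_sub, add_dotProduct, sub_dotProduct, dotProduct_add,
    dotProduct_sub, Matrix.mulVec_single_one, single_one_dotProduct, Matrix.col_apply, hs]
  ring

theorem Matrix.tendsto_zero_of_quadForm {P : ℕ → Matrix ν ν ℝ} (hs : ∀ k, (P k)ᵀ = P k)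
    (h : ∀ x, Tendsto (fun k => x ⬝ᵥ P k *ᵥ x) atTop (𝓝 0)) : Tendsto P atTop (𝓝 0) := by
  classical
  refine tendsto_pi_nhds.2 fun i => tendsto_pi_nhds.2 fun j => ?_
  simp_rw [fun k => Matrix.apply_eq_polarization (hs k) i j]
  have := ((h (Pi.single i 1 + Pi.single j 1)).sub (h (Pi.single i 1 - Pi.single j 1))).div_const 4
  rwa [sub_zero, zero_div] at this

theorem Matrix.exists_tendsto_of_quadForm {P : ℕ → Matrix ν ν ℝ} (hs : ∀ k, (P k)ᵀ = P k)
    (h : ∀ x, ∃ l, Tendsto (fun k => x ⬝ᵥ P k *ᵥ x) atTop (𝓝 l)) : ∃ M, Tendsto P atTop (𝓝 M) := by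
  classical
  choose l hl using h
  refine ⟨fun i j => (l (Pi.single i 1 + Pi.single j 1) - l (Pi.single i 1 - Pi.single j 1)) / 4,
    tendsto_pi_nhds.2 fun i => tendsto_pi_nhds.2 fun j => ?_⟩
  simp_rw [fun k => Matrix.apply_eq_polarization (hs k) i j]
  exact ((hl _).sub (hl _)).div_const 4

theorem Matrix.tendsto_quadForm {P : ℕ → Matrix ν ν ℝ} {M : Matrix ν ν ℝ}
    (h : Tendsto P atTop (𝓝 M)) (x : ν → ℝ) :
    Tendsto (fun k => x ⬝ᵥ P k *ᵥ x) atTop (𝓝 (x ⬝ᵥ M *ᵥ x)) := by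
  have hc : Continuous fun N : Matrix ν ν ℝ => x ⬝ᵥ N *ᵥ x := by fun_prop
  exact (hc.tendsto M).comp h

theorem Matrix.posSemidef_of_tendsto {P : ℕ → Matrix ν ν ℝ} {M : Matrix ν ν ℝ}
    (h : Tendsto P atTop (𝓝 M)) (hP : ∀ᶠ k in atTop, (P k).PosSemidef) : M.PosSemidef := by
  refine Matrix.posSemidef_iff_real.2 ⟨?_, fun x => ?_⟩
  · have hc : Continuous fun N : Matrix ν ν ℝ => Nᵀ := by fun_prop
    refine tendsto_nhds_unique_of_eventuallyEq ((hc.tendsto M).comp h) h ?_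
    filter_upwards [hP] with k hk using hk.transpose_eq
  · refine ge_of_tendsto (Matrix.tendsto_quadForm h x) ?_
    filter_upwards [hP] with k hk using hk.quadForm_nonneg x

theorem Matrix.le_of_tendsto_le {P P' : ℕ → Matrix ν ν ℝ} {M M' : Matrix ν ν ℝ}
    (h : Tendsto P atTop (𝓝 M)) (h' : Tendsto P' atTop (𝓝 M')) (hP : ∀ k, P k ≤ P' k) : M ≤ M' :=
  Matrix.le_iff.2 <| Matrix.posSemidef_of_tendsto (h'.sub h) <|
    Eventually.of_forall fun k => Matrix.le_iff.1 (hP k)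

/-- A decreasing sequence of positive semidefinite matrices converges. -/
theorem Matrix.exists_tendsto_of_antitone {P : ℕ → Matrix ν ν ℝ} (hP : ∀ k, (P k).PosSemidef)
    (hanti : ∀ k, P (k + 1) ≤ P k) : ∃ M, Tendsto P atTop (𝓝 M) := by
  refine Matrix.exists_tendsto_of_quadForm (fun k => (hP k).transpose_eq) fun x => ?_
  have ha : Antitone fun k => x ⬝ᵥ P k *ᵥ x := antitone_nat_of_succ_le fun k => by
    have := (Matrix.le_iff.1 (hanti k)).quadForm_nonneg x
    rw [Matrix.sub_mulVec, dotProduct_sub] at this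
    linarith
  exact ⟨_, tendsto_atTop_ciInf ha ⟨0, by rintro _ ⟨k, rfl⟩; exact (hP k).quadForm_nonneg x⟩⟩

theorem Matrix.abs_bilin_le (P : Matrix ν ν ℝ) (x y : ν → ℝ) :
    |x ⬝ᵥ P *ᵥ y| ≤ (∑ i, ∑ j, |P i j|) * (x ⬝ᵥ x + y ⬝ᵥ y) := by
  have hx : ∀ (z : ν → ℝ) i, z i ^ 2 ≤ z ⬝ᵥ z := fun z i => by
    have := Finset.single_le_sum (f := fun i => z i * z i) (fun i _ => mul_self_nonneg (z i))
      (Finset.mem_univ i)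
    simpa [dotProduct, sq] using this
  have : x ⬝ᵥ P *ᵥ y = ∑ i, ∑ j, P i j * (x i * y j) := by
    simp only [dotProduct, Matrix.mulVec, Finset.mul_sum]
    exact Finset.sum_congr rfl fun i _ => Finset.sum_congr rfl fun j _ => by ring
  rw [this, Finset.sum_mul]
  refine (Finset.abs_sum_le_sum_abs _ _).trans (Finset.sum_le_sum fun i _ => ?_)
  rw [Finset.sum_mul]
  refine (Finset.abs_sum_le_sum_abs _ _).trans (Finset.sum_le_sum fun j _ => ?_)
  rw [abs_mul]
  refine mul_le_mul_of_nonneg_left (abs_le.2 ⟨?_, ?_⟩) (abs_nonneg _) <;>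
    nlinarith [hx x i, hx y j, sq_nonneg (x i + y j), sq_nonneg (x i - y j)]

/-- On a finite-dimensional space a positive definite form dominates every form up to a factor. -/
theorem Matrix.PosDef.exists_smul_le {P : Matrix ν ν ℝ} (hP : P.PosDef) (M : Matrix ν ν ℝ)
    (hM : Mᵀ = M) : ∃ ε > (0 : ℝ), ∀ δ : ℝ, 0 ≤ δ → δ ≤ ε → δ • M ≤ P := by
  classical
  -- The factor 2 arises from `Matrix.abs_bilin_le` at `y = x`, where `x ⬝ᵥ x` is counted twice.
  set c := 2 * ∑ i, ∑ j, |M i j| with hc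
  -- The constant `a` is the minimum of the form on the Euclidean unit sphere, extended to all
  -- vectors by homogeneity.
  obtain ⟨a, ha, hPa⟩ : ∃ a > 0, ∀ x : ν → ℝ, a * (x ⬝ᵥ x) ≤ x ⬝ᵥ P *ᵥ x := by
    by_cases hne : Nonempty ν
    swap
    · rw [not_nonempty_iff] at hne
      exact ⟨1, one_pos, fun x => by simp [dotProduct]⟩
    have hcomp : IsCompact (Metric.sphere (0 : EuclideanSpace ℝ ν) 1) := isCompact_sphere _ _
    have hnonempty : (Metric.sphere (0 : EuclideanSpace ℝ ν) 1).Nonempty :=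
      NormedSpace.sphere_nonempty.2 zero_le_one
    obtain ⟨z, hz, hmin⟩ := hcomp.exists_isMinOn hnonempty
      (f := fun z : EuclideanSpace ℝ ν => z.ofLp ⬝ᵥ P *ᵥ z.ofLp) (by fun_prop)
    have hz0 : z.ofLp ≠ 0 := by
      intro h0
      have : z = 0 := by ext i; simp [h0]
      simp [this] at hz
    refine ⟨z.ofLp ⬝ᵥ P *ᵥ z.ofLp, by simpa using hP.dotProduct_mulVec_pos hz0, fun x => ?_⟩
    by_cases hx : x = 0
    · simp [hx]
    set r := ‖WithLp.toLp 2 x‖ with hr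
    have hr0 : 0 < r := by
      rw [hr, norm_pos_iff]; intro h; exact hx (by simpa using congrArg WithLp.ofLp h)
    have hrr : x ⬝ᵥ x = r ^ 2 := by
      rw [hr, EuclideanSpace.norm_sq_eq]; simp [dotProduct, sq]
    have hmem : r⁻¹ • WithLp.toLp 2 x ∈ Metric.sphere (0 : EuclideanSpace ℝ ν) 1 := by
      simp only [mem_sphere_zero_iff_norm, norm_smul, norm_inv, Real.norm_eq_abs, abs_of_pos hr0]
      exact inv_mul_cancel₀ hr0.ne'
    have := hmin hmem
    simp only [Set.mem_ofPred_eq, WithLp.ofLp_smul, Matrix.mulVec_smul, dotProduct_smul,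
      smul_dotProduct, smul_eq_mul] at this
    rw [hrr]
    calc _ ≤ (r⁻¹ * (r⁻¹ * (x ⬝ᵥ P *ᵥ x))) * r ^ 2 := by gcongr
      _ = _ := by field_simp
  have hc0 : 0 ≤ c := by positivity
  refine ⟨a / (c + 1), by positivity, fun δ hδ hδε => Matrix.le_iff.2 <|
    Matrix.posSemidef_iff_real.2 ⟨?_, fun x => ?_⟩⟩
  · rw [Matrix.transpose_sub, Matrix.transpose_smul, hM, hP.posSemidef.transpose_eq]
  · rw [Matrix.sub_mulVec, dotProduct_sub, Matrix.smul_mulVec, dotProduct_smul, smul_eq_mul]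
    have hb := (le_abs_self _).trans (Matrix.abs_bilin_le M x x)
    have hxx : 0 ≤ x ⬝ᵥ x := Finset.sum_nonneg fun i _ => mul_self_nonneg (x i)
    have h1 : δ * (x ⬝ᵥ M *ᵥ x) ≤ δ * (c * (x ⬝ᵥ x)) :=
      mul_le_mul_of_nonneg_left (by rw [hc]; linarith) hδ
    have h2 : δ * (c + 1) ≤ a := (le_div_iff₀ (by positivity)).1 hδε
    nlinarith [hPa x, mul_le_mul_of_nonneg_right h2 hxx, mul_nonneg hδ hxx]

end QuadraticForms

/-! ### Positive operators on families of matrices: comparison and contraction -/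

section CongruenceOperator

variable {ν ι : Type*} [Fintype ν]

/-- The positive operator `P ↦ (F_i' P_{σ i} F_i + G_i' P_o G_i)_i` on families of matrices. -/
def congrOp (σ : ι → ι) (o : ι) (F G : ι → Matrix ν ν ℝ) :
    (ι → Matrix ν ν ℝ) →ₗ[ℝ] (ι → Matrix ν ν ℝ) where
  toFun P i := (F i)ᵀ * P (σ i) * F i + (G i)ᵀ * P o * G i
  map_add' P P' := by
    funext i
    simp only [Pi.add_apply, Matrix.mul_add, Matrix.add_mul]
    abel
  map_smul' c P := by
    funext i
    simp [Matrix.mul_smul, Matrix.smul_mul, smul_add]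

variable {σ : ι → ι} {o : ι} {F G : ι → Matrix ν ν ℝ}

theorem congrOp_apply (P : ι → Matrix ν ν ℝ) (i : ι) :
    congrOp σ o F G P i = (F i)ᵀ * P (σ i) * F i + (G i)ᵀ * P o * G i := rfl

theorem dotProduct_congrOp_mulVec (P : ι → Matrix ν ν ℝ) (i : ι) (x y : ν → ℝ) :
    x ⬝ᵥ congrOp σ o F G P i *ᵥ y =
      (F i *ᵥ x) ⬝ᵥ P (σ i) *ᵥ (F i *ᵥ y) + (G i *ᵥ x) ⬝ᵥ P o *ᵥ (G i *ᵥ y) := by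
  rw [congrOp_apply, Matrix.add_mulVec, dotProduct_add, Matrix.quadForm_congr_mul,
    Matrix.quadForm_congr_mul]

theorem congrOp_nonneg {P : ι → Matrix ν ν ℝ} (h : 0 ≤ P) : 0 ≤ congrOp σ o F G P := fun _ =>
  Matrix.nonneg_iff_posSemidef.2 <|
    ((Matrix.nonneg_iff_posSemidef.1 (h _)).congr_mul _).add
      ((Matrix.nonneg_iff_posSemidef.1 (h _)).congr_mul _)

theorem congrOp_pow_nonneg (k : ℕ) {P : ι → Matrix ν ν ℝ} (h : 0 ≤ P) :
    0 ≤ (congrOp σ o F G ^ k) P := by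
  induction k with
  | zero => simpa using h
  | succ k ih =>
    rw [pow_succ', Module.End.mul_apply]
    exact congrOp_nonneg ih

theorem congrOp_pow_mono (k : ℕ) {P P' : ι → Matrix ν ν ℝ} (h : P ≤ P') :
    (congrOp σ o F G ^ k) P ≤ (congrOp σ o F G ^ k) P' := by
  rw [← sub_nonneg, ← map_sub]
  exact congrOp_pow_nonneg k (sub_nonneg.2 h)

theorem congrOp_pow_le {P : ι → Matrix ν ν ℝ} (h : congrOp σ o F G P ≤ P) (k : ℕ) :
    (congrOp σ o F G ^ (k + 1)) P ≤ (congrOp σ o F G ^ k) P := by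
  rw [pow_succ]
  exact congrOp_pow_mono k h

/-- All orbits of a linear operator on families of matrices tend to zero. -/
def Contracting (L : (ι → Matrix ν ν ℝ) →ₗ[ℝ] (ι → Matrix ν ν ℝ)) : Prop :=
  ∀ P, Tendsto (fun k => (L ^ k) P) atTop (𝓝 0)

/-- Domination is stated for bilinear forms because `M` need not be symmetric, so its entries cannot
be read from its quadratic form. The bound passes through each congruence by substituting `F i *ᵥ x`
and `F i *ᵥ y`, and likewise for `G i`. -/
theorem abs_congrOp_pow_le {M P : ι → Matrix ν ν ℝ}
    (h : ∀ i x y, |x ⬝ᵥ M i *ᵥ y| ≤ x ⬝ᵥ P i *ᵥ x + y ⬝ᵥ P i *ᵥ y) (k : ℕ) (i : ι) (x y : ν → ℝ) :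
    |x ⬝ᵥ (congrOp σ o F G ^ k) M i *ᵥ y| ≤
      x ⬝ᵥ (congrOp σ o F G ^ k) P i *ᵥ x + y ⬝ᵥ (congrOp σ o F G ^ k) P i *ᵥ y := by
  induction k generalizing i x y with
  | zero => simpa using h i x y
  | succ k ih =>
    rw [pow_succ']
    simp only [Module.End.mul_apply, dotProduct_congrOp_mulVec]
    refine (abs_add_le _ _).trans ?_
    linarith [ih (σ i) (F i *ᵥ x) (F i *ᵥ y), ih o (G i *ᵥ x) (G i *ᵥ y)]

/-- If one positive definite family is driven to zero, every family is. -/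
theorem contracting_of_posDef [Finite ι] {P : ι → Matrix ν ν ℝ} (hP : ∀ i, (P i).PosDef)
    (h : Tendsto (fun k => (congrOp σ o F G ^ k) P) atTop (𝓝 0)) :
    Contracting (congrOp σ o F G) := by
  classical
  intro M
  -- The bound is claimed for every larger constant too, so that the sum of the `c i` serves all
  -- components at once; the operator mixes them.
  have hdom : ∀ i, ∃ c > (0 : ℝ), ∀ c', c ≤ c' → ∀ x y,
      |x ⬝ᵥ M i *ᵥ y| ≤ c' * (x ⬝ᵥ P i *ᵥ x + y ⬝ᵥ P i *ᵥ y) := fun i => by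
    obtain ⟨ε, hε, hle⟩ := (hP i).exists_smul_le 1 Matrix.transpose_one
    have hle := Matrix.le_iff.1 (hle ε hε.le le_rfl)
    set s := ∑ i', ∑ j', |M i i' j'|
    have hs : 0 ≤ s := by positivity
    refine ⟨(s + 1) / ε, by positivity, fun c' hc' x y => ?_⟩
    have hq : ∀ z : ν → ℝ, ε * (z ⬝ᵥ z) ≤ z ⬝ᵥ P i *ᵥ z := fun z => by
      have := hle.quadForm_nonneg z
      rw [Matrix.sub_mulVec, dotProduct_sub, Matrix.smul_mulVec, dotProduct_smul,
        Matrix.one_mulVec, smul_eq_mul] at this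
      linarith
    have hz : ∀ z : ν → ℝ, 0 ≤ z ⬝ᵥ z := fun z => Finset.sum_nonneg fun i _ => mul_self_nonneg (z i)
    have h1 : s ≤ c' * ε := by
      have := (div_le_iff₀ hε).1 hc'
      linarith
    have hc0 : 0 ≤ c' := le_trans (by positivity) hc'
    calc |x ⬝ᵥ M i *ᵥ y| ≤ s * (x ⬝ᵥ x + y ⬝ᵥ y) := Matrix.abs_bilin_le _ _ _
      _ ≤ c' * ε * (x ⬝ᵥ x + y ⬝ᵥ y) :=
        mul_le_mul_of_nonneg_right h1 (add_nonneg (hz x) (hz y))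
      _ = c' * (ε * (x ⬝ᵥ x) + ε * (y ⬝ᵥ y)) := by ring
      _ ≤ _ := mul_le_mul_of_nonneg_left (add_le_add (hq x) (hq y)) hc0
  choose c hc hdom using hdom
  have := Fintype.ofFinite ι
  have hdom' : ∀ i x y, |x ⬝ᵥ M i *ᵥ y| ≤ x ⬝ᵥ ((∑ i, c i) • P) i *ᵥ x +
      y ⬝ᵥ ((∑ i, c i) • P) i *ᵥ y := fun i x y => by
    simp only [Pi.smul_apply, Matrix.smul_mulVec, dotProduct_smul, smul_eq_mul, ← mul_add]
    exact hdom i _ (Finset.single_le_sum (fun i _ => (hc i).le) (Finset.mem_univ i)) x y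
  refine tendsto_pi_nhds.2 fun i => tendsto_pi_nhds.2 fun a => tendsto_pi_nhds.2 fun b => ?_
  have h' : Tendsto (fun k => (congrOp σ o F G ^ k) ((∑ i, c i) • P) i) atTop (𝓝 0) := by
    have := tendsto_pi_nhds.1 (h.const_smul (∑ i, c i)) i
    simpa using this
  refine squeeze_zero_norm (fun k => ?_) (by
    simpa using (Matrix.tendsto_quadForm h' (Pi.single a 1)).add
      (Matrix.tendsto_quadForm h' (Pi.single b 1)))
  have := abs_congrOp_pow_le (σ := σ) (o := o) (F := F) (G := G) hdom' k i (Pi.single a 1)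
    (Pi.single b 1)
  simpa using this

/-- Comparison principle: the iterates of `D` decrease from `D` to their limit 0. -/
theorem nonneg_of_congrOp_le (hL : Contracting (congrOp σ o F G)) {D : ι → Matrix ν ν ℝ}
    (h : congrOp σ o F G D ≤ D) : 0 ≤ D := by
  have hk : ∀ k, (congrOp σ o F G ^ k) D ≤ D := fun k => by
    induction k with
    | zero => simp
    | succ k ih => exact (congrOp_pow_le h k).trans ih
  intro i
  exact Matrix.le_of_tendsto_le (tendsto_pi_nhds.1 (hL D) i) tendsto_const_nhds fun k => hk k i

/-- A fixed point of the operator has a constant orbit, hence is zero. So `id - L` is injective, and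
in finite dimension bijective. -/
theorem existsUnique_congrOp_add [Finite ι] (hL : Contracting (congrOp σ o F G))
    (C : ι → Matrix ν ν ℝ) : ∃! P, P = congrOp σ o F G P + C := by
  have hinj : Function.Injective
      (LinearMap.id - congrOp σ o F G : (ι → Matrix ν ν ℝ) →ₗ[ℝ] (ι → Matrix ν ν ℝ)) := by
    rw [← LinearMap.ker_eq_bot, LinearMap.ker_eq_bot']
    intro D hD
    have hfix : congrOp σ o F G D = D := by
      exact (sub_eq_zero.1 (by simpa using hD)).symm
    have hk : ∀ k, (congrOp σ o F G ^ k) D = D := fun k => by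
      induction k with
      | zero => simp
      | succ k ih => rw [pow_succ, Module.End.mul_apply, hfix, ih]
    have := hL D
    simp only [hk] at this
    exact tendsto_nhds_unique tendsto_const_nhds this
  have hiff : ∀ P, P = congrOp σ o F G P + C ↔
      (LinearMap.id - congrOp σ o F G : (ι → Matrix ν ν ℝ) →ₗ[ℝ] (ι → Matrix ν ν ℝ)) P = C := fun P => by
    rw [LinearMap.sub_apply, LinearMap.id_apply, sub_eq_iff_eq_add, add_comm C]
  have := Fintype.ofFinite ι
  obtain ⟨P, hP⟩ := LinearMap.injective_iff_surjective.1 hinj C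
  refine ⟨P, (hiff P).2 hP, fun P' hP' => hinj ?_⟩
  rw [hP, (hiff P').1 hP']

theorem exists_smul_le_family [Finite ι] {P M : ι → Matrix ν ν ℝ} (hP : ∀ i, (P i).PosDef)
    (hM : ∀ i, (M i)ᵀ = M i) : ∃ ε > (0 : ℝ), ε • M ≤ P := by
  choose ε hε hle using fun i => (hP i).exists_smul_le (M i) (hM i)
  obtain ⟨δ, hδ, hδle⟩ : ∃ δ > (0 : ℝ), ∀ i, δ ≤ ε i := by
    have := Fintype.ofFinite ι
    by_cases hne : Nonempty ι
    · obtain ⟨i₀, -, hi₀⟩ := Finset.exists_min_image Finset.univ ε Finset.univ_nonempty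
      exact ⟨ε i₀, hε i₀, fun i => hi₀ i (Finset.mem_univ i)⟩
    · exact ⟨1, one_pos, fun i => (hne ⟨i⟩).elim⟩
  exact ⟨δ, hδ, fun i => hle i δ hδ.le (hδle i)⟩

/-- A nonnegative supersolution of the Lyapunov equation makes the operator contracting, provided
that all such supersolutions are positive definite. -/
theorem contracting_of_supersolution [Finite ι] {C : ι → Matrix ν ν ℝ} (hC : 0 ≤ C)
    (hpos : ∀ D, 0 ≤ D → congrOp σ o F G D + C ≤ D → ∀ i, (D i).PosDef)
    {P : ι → Matrix ν ν ℝ} (hP : 0 ≤ P) (h : congrOp σ o F G P + C ≤ P) :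
    Contracting (congrOp σ o F G) := by
  set L := congrOp σ o F G with hLdef
  have hLP : L P ≤ P := le_trans (le_add_of_nonneg_right hC) h
  have hlim : ∀ i, ∃ M, Tendsto (fun k => (L ^ k) P i) atTop (𝓝 M) := fun i =>
    Matrix.exists_tendsto_of_antitone
      (fun k => Matrix.nonneg_iff_posSemidef.1 (congrOp_pow_nonneg k hP i))
      fun k => congrOp_pow_le hLP k i
  choose Pinf hPinf using hlim
  have hlim : Tendsto (fun k => (L ^ k) P) atTop (𝓝 Pinf) := tendsto_pi_nhds.2 hPinf
  have hcont : Continuous L := by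
    refine continuous_pi fun i => ?_
    simp only [hLdef, congrOp_apply]
    fun_prop
  have hfix : L Pinf = Pinf := by
    refine tendsto_nhds_unique ((hcont.tendsto _).comp hlim) ?_
    have := (tendsto_add_atTop_iff_nat 1).2 hlim
    refine this.congr fun k => ?_
    rw [pow_succ']; rfl
  have hfixk : ∀ k, (L ^ k) Pinf = Pinf := fun k => by
    induction k with
    | zero => simp
    | succ k ih => rw [pow_succ, Module.End.mul_apply, hfix, ih]
  have hinf0 : 0 ≤ Pinf := fun i => Matrix.nonneg_iff_posSemidef.2 <|
    Matrix.posSemidef_of_tendsto (hPinf i) <| Eventually.of_forall fun k =>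
      Matrix.nonneg_iff_posSemidef.1 (congrOp_pow_nonneg k hP i)
  have hkle : ∀ k, (L ^ k) P ≤ P := fun k => by
    induction k with
    | zero => simp
    | succ k ih => exact (congrOp_pow_le hLP k).trans ih
  have hinfle : Pinf ≤ P := fun i =>
    Matrix.le_of_tendsto_le (hPinf i) tendsto_const_nhds fun k => hkle k i
  -- Subtracting the fixed point `Pinf` leaves a nonnegative supersolution, so the positivity
  -- hypothesis applies to the difference.
  have hD : ∀ i, ((P - Pinf) i).PosDef := by
    refine hpos _ (sub_nonneg.2 hinfle) ?_
    rw [map_sub, hfix, sub_add_eq_add_sub]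
    exact sub_le_sub_right h _
  obtain ⟨ε, hε, hεle⟩ := exists_smul_le_family hD fun i =>
    (Matrix.nonneg_iff_posSemidef.1 (hP i)).transpose_eq
  have hzero : Pinf = 0 := by
    funext i
    -- Apply `L ^ k` to `ε • P ≤ P - Pinf`. Since `Pinf` is fixed, the limit reads `ε • Pinf ≤ Pinf
    -- - Pinf`.
    have hle : ε • Pinf i ≤ 0 := by
      have hk : ∀ k, ε • (L ^ k) P i ≤ (L ^ k) P i - Pinf i := fun k => by
        have := congrOp_pow_mono (σ := σ) (o := o) (F := F) (G := G) k hεle i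
        rw [map_sub, map_smul, ← hLdef, hfixk] at this
        exact this
      have := Matrix.le_of_tendsto_le ((hPinf i).const_smul ε) ((hPinf i).sub_const _) hk
      rwa [sub_self] at this
    have hge : 0 ≤ ε • Pinf i := Matrix.nonneg_iff_posSemidef.2
      ((Matrix.nonneg_iff_posSemidef.1 (hinf0 i)).smul hε.le)
    exact (smul_eq_zero.1 (le_antisymm hle hge)).resolve_left hε.ne'
  exact contracting_of_posDef (hpos P hP h) (hzero ▸ hlim)

end CongruenceOperator

/-! ### The Lyapunov operator, observability and improvement of the gain -/

theorem Matrix.quadForm_add {ν : Type*} [Fintype ν] {P : Matrix ν ν ℝ} (hP : Pᵀ = P)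
    (x y : ν → ℝ) : (x + y) ⬝ᵥ P *ᵥ (x + y) = x ⬝ᵥ P *ᵥ x + 2 * (y ⬝ᵥ P *ᵥ x) + y ⬝ᵥ P *ᵥ y := by
  have : x ⬝ᵥ P *ᵥ y = y ⬝ᵥ P *ᵥ x := by
    rw [Matrix.dotProduct_mulVec, ← Matrix.mulVec_transpose, hP, dotProduct_comm]
  rw [Matrix.mulVec_add, add_dotProduct, dotProduct_add, dotProduct_add, this]
  ring

namespace NoisySystem

variable {n m d : ℕ} (S : NoisySystem n m)

/-- The homogeneous part of the coupled Lyapunov equations for the gain `K`. -/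
noncomputable def lyapOp (d : ℕ) (K : Matrix (Fin m) (Fin n) ℝ) :
    (Fin (d + 1) → Matrix (Fin n) (Fin n) ℝ) →ₗ[ℝ] (Fin (d + 1) → Matrix (Fin n) (Fin n) ℝ) :=
  congrOp (Fin.lastCases (Fin.last d) Fin.succ) 0
    (Fin.lastCases (S.A - S.B * K) fun _ => S.A)
    (Fin.lastCases (S.Abar - S.Bbar * K) fun _ => S.Abar)

/-- The inhomogeneous part of the coupled Lyapunov equations for the gain `K`. -/
noncomputable def runCost (d : ℕ) (Q : Matrix (Fin n) (Fin n) ℝ) (R : Matrix (Fin m) (Fin m) ℝ)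
    (K : Matrix (Fin m) (Fin n) ℝ) : Fin (d + 1) → Matrix (Fin n) (Fin n) ℝ :=
  Fin.lastCases (Kᵀ * R * K + Q) fun _ => Q

theorem lyapOp_castSucc (K : Matrix (Fin m) (Fin n) ℝ)
    (P : Fin (d + 1) → Matrix (Fin n) (Fin n) ℝ) (i : Fin d) :
    S.lyapOp d K P i.castSucc = S.Aᵀ * P i.succ * S.A + S.Abarᵀ * P 0 * S.Abar := by
  simp [lyapOp, congrOp_apply]

theorem lyapOp_last (K : Matrix (Fin m) (Fin n) ℝ)
    (P : Fin (d + 1) → Matrix (Fin n) (Fin n) ℝ) :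
    S.lyapOp d K P (Fin.last d) = (S.A - S.B * K)ᵀ * P (Fin.last d) * (S.A - S.B * K)
      + (S.Abar - S.Bbar * K)ᵀ * P 0 * (S.Abar - S.Bbar * K) := by
  simp [lyapOp, congrOp_apply]

variable {Q : Matrix (Fin n) (Fin n) ℝ} {R : Matrix (Fin m) (Fin m) ℝ}

theorem lyapunovEqs_iff {K : Matrix (Fin m) (Fin n) ℝ}
    {P : Fin (d + 1) → Matrix (Fin n) (Fin n) ℝ} :
    S.LyapunovEqs Q R K P ↔ P = S.lyapOp d K P + runCost d Q R K := by
  constructor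
  · rintro ⟨h1, h2⟩
    funext i
    refine Fin.lastCases ?_ (fun i => ?_) i
    · rw [Pi.add_apply, lyapOp_last]
      simpa [runCost, add_assoc] using h2
    · rw [Pi.add_apply, lyapOp_castSucc]
      simpa [runCost] using h1 i
  · intro h
    refine ⟨fun i => ?_, ?_⟩
    · have := congrFun h i.castSucc
      rw [Pi.add_apply, lyapOp_castSucc] at this
      simpa [runCost] using this
    · have := congrFun h (Fin.last d)
      rw [Pi.add_apply, lyapOp_last] at this
      simpa [runCost, add_assoc] using this

theorem runCost_nonneg (hQ : Q.PosSemidef) (hR : R.PosDef) (K : Matrix (Fin m) (Fin n) ℝ) :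
    0 ≤ runCost d Q R K := by
  intro i
  refine Matrix.nonneg_iff_posSemidef.2 ?_
  refine Fin.lastCases ?_ (fun i => ?_) i
  · simpa [runCost] using (hR.posSemidef.congr_mul K).add hQ
  · simpa [runCost] using hQ

/-- `E[x_k' Q x_k] = x_0' (obsGram k) x_0` for the uncontrolled system. -/
def obsGram (Q : Matrix (Fin n) (Fin n) ℝ) : ℕ → Matrix (Fin n) (Fin n) ℝ
  | 0 => Q
  | k + 1 => S.Aᵀ * obsGram Q k * S.A + S.Abarᵀ * obsGram Q k * S.Abar

/-- Exact observability, expressed by second moments. -/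
def GramObservable (Q : Matrix (Fin n) (Fin n) ℝ) : Prop :=
  ∀ x, (∀ k, x ⬝ᵥ S.obsGram Q k *ᵥ x = 0) → x = 0

variable {S}

/-- If `x` is null for `D i`, the supersolution inequality kills every nonnegative term: `x` is null
for `Q`, `Abar x` for `D 0`, and `A x` for some `D i'`. In the last component `R > 0` forces `K x =
0`, so the closed-loop matrices act on `x` as `A` and `Abar`. By induction all `obsGram` forms
vanish at `x`. -/
theorem GramObservable.posDef (hobs : S.GramObservable Q) (hQ : Q.PosSemidef) (hR : R.PosDef)
    {K : Matrix (Fin m) (Fin n) ℝ} (D : Fin (d + 1) → Matrix (Fin n) (Fin n) ℝ) (hD : 0 ≤ D)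
    (h : S.lyapOp d K D + runCost d Q R K ≤ D) (i : Fin (d + 1)) : (D i).PosDef := by
  have hpsd : ∀ i, (D i).PosSemidef := fun i => Matrix.nonneg_iff_posSemidef.1 (hD i)
  have hstep : ∀ i x, x ⬝ᵥ D i *ᵥ x = 0 → x ⬝ᵥ Q *ᵥ x = 0 ∧
      (∃ i', (S.A *ᵥ x) ⬝ᵥ D i' *ᵥ (S.A *ᵥ x) = 0) ∧
      (S.Abar *ᵥ x) ⬝ᵥ D 0 *ᵥ (S.Abar *ᵥ x) = 0 := by
    intro i x hx
    have hle := (Matrix.le_iff.1 (h i)).quadForm_nonneg x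
    rw [Matrix.sub_mulVec, dotProduct_sub, hx, Pi.add_apply] at hle
    revert hle
    refine Fin.lastCases ?_ (fun i => ?_) i
    · rw [lyapOp_last]
      simp only [runCost, Fin.lastCases_last, Matrix.add_mulVec, dotProduct_add,
        Matrix.quadForm_congr_mul]
      intro hle
      have h1 := (hpsd (Fin.last d)).quadForm_nonneg ((S.A - S.B * K) *ᵥ x)
      have h2 := (hpsd 0).quadForm_nonneg ((S.Abar - S.Bbar * K) *ᵥ x)
      have h3 := hR.posSemidef.quadForm_nonneg (K *ᵥ x)
      have h4 := hQ.quadForm_nonneg x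
      have hK : K *ᵥ x = 0 := hR.eq_zero_of_quadForm (by linarith)
      have hA : (S.A - S.B * K) *ᵥ x = S.A *ᵥ x := by
        rw [Matrix.sub_mulVec, ← Matrix.mulVec_mulVec, hK]; simp
      have hAbar : (S.Abar - S.Bbar * K) *ᵥ x = S.Abar *ᵥ x := by
        rw [Matrix.sub_mulVec, ← Matrix.mulVec_mulVec, hK]; simp
      rw [hA] at h1 hle
      rw [hAbar] at h2 hle
      exact ⟨by linarith, ⟨Fin.last d, by linarith⟩, by linarith⟩
    · rw [lyapOp_castSucc]
      simp only [runCost, Fin.lastCases_castSucc, Matrix.add_mulVec, dotProduct_add,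
        Matrix.quadForm_congr_mul]
      intro hle
      have h1 := (hpsd i.succ).quadForm_nonneg (S.A *ᵥ x)
      have h2 := (hpsd 0).quadForm_nonneg (S.Abar *ᵥ x)
      have h4 := hQ.quadForm_nonneg x
      exact ⟨by linarith, ⟨i.succ, by linarith⟩, by linarith⟩
  refine Matrix.posDef_of_ker (hpsd i) fun x hx => hobs x fun k => ?_
  induction k generalizing i x with
  | zero => exact (hstep i x hx).1
  | succ k ih =>
    obtain ⟨-, ⟨i', hi'⟩, h0⟩ := hstep i x hx
    rw [obsGram, Matrix.add_mulVec, dotProduct_add, Matrix.quadForm_congr_mul,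
      Matrix.quadForm_congr_mul, ih i' _ hi', ih 0 _ h0, add_zero]

variable (S) in
/-- The weight `R + B' P^d B + Bbar' P^0 Bbar` of the control. -/
def gainWeight (R : Matrix (Fin m) (Fin m) ℝ) (P : Fin (d + 1) → Matrix (Fin n) (Fin n) ℝ) :
    Matrix (Fin m) (Fin m) ℝ :=
  R + S.Bᵀ * P (Fin.last d) * S.B + S.Bbarᵀ * P 0 * S.Bbar

theorem gainWeight_posDef (hR : R.PosDef) {P : Fin (d + 1) → Matrix (Fin n) (Fin n) ℝ}
    (hP : 0 ≤ P) : (S.gainWeight R P).PosDef :=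
  (hR.add_posSemidef ((Matrix.nonneg_iff_posSemidef.1 (hP _)).congr_mul _)).add_posSemidef
    ((Matrix.nonneg_iff_posSemidef.1 (hP _)).congr_mul _)

theorem gainWeight_mul_gain (hR : R.PosDef) {P : Fin (d + 1) → Matrix (Fin n) (Fin n) ℝ}
    (hP : 0 ≤ P) : S.gainWeight R P * S.gain R P =
      S.Bᵀ * P (Fin.last d) * S.A + S.Bbarᵀ * P 0 * S.Abar := by
  have hu : IsUnit (S.gainWeight R P).det :=
    (Matrix.isUnit_iff_isUnit_det _).1 (gainWeight_posDef hR hP).isUnit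
  exact Matrix.mul_nonsing_inv_cancel_left _ _ hu

/-- Completion of the square in the one-step cost. -/
theorem quadForm_complete_square (hR : R.PosDef) {P : Fin (d + 1) → Matrix (Fin n) (Fin n) ℝ}
    (hP : 0 ≤ P) (x : Fin n → ℝ) (v : Fin m → ℝ) :
    (S.A *ᵥ x + S.B *ᵥ v) ⬝ᵥ P (Fin.last d) *ᵥ (S.A *ᵥ x + S.B *ᵥ v) +
      (S.Abar *ᵥ x + S.Bbar *ᵥ v) ⬝ᵥ P 0 *ᵥ (S.Abar *ᵥ x + S.Bbar *ᵥ v) + v ⬝ᵥ R *ᵥ v =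
    x ⬝ᵥ (S.lyapOp d (S.gain R P) P (Fin.last d) + (S.gain R P)ᵀ * R * S.gain R P) *ᵥ x +
      (v + S.gain R P *ᵥ x) ⬝ᵥ S.gainWeight R P *ᵥ (v + S.gain R P *ᵥ x) := by
  set K := S.gain R P with hK
  set u := v + K *ᵥ x with hu
  have hv : v = -(K *ᵥ x) + u := by rw [hu]; abel
  have hlast := (Matrix.nonneg_iff_posSemidef.1 (hP (Fin.last d))).transpose_eq
  have hzero := (Matrix.nonneg_iff_posSemidef.1 (hP 0)).transpose_eq
  have hA : S.A *ᵥ x + S.B *ᵥ v = (S.A - S.B * K) *ᵥ x + S.B *ᵥ u := by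
    rw [hv, Matrix.mulVec_add, Matrix.sub_mulVec, Matrix.mulVec_neg, Matrix.mulVec_mulVec]; abel
  have hAbar : S.Abar *ᵥ x + S.Bbar *ᵥ v = (S.Abar - S.Bbar * K) *ᵥ x + S.Bbar *ᵥ u := by
    rw [hv, Matrix.mulVec_add, Matrix.sub_mulVec, Matrix.mulVec_neg, Matrix.mulVec_mulVec]; abel
  -- The cross terms in `u` cancel: this is the normal equation `gainWeight_mul_gain` that defines
  -- the gain.
  have hkey : (S.B *ᵥ u) ⬝ᵥ P (Fin.last d) *ᵥ ((S.A - S.B * K) *ᵥ x) +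
      (S.Bbar *ᵥ u) ⬝ᵥ P 0 *ᵥ ((S.Abar - S.Bbar * K) *ᵥ x) - u ⬝ᵥ R *ᵥ (K *ᵥ x) = 0 := by
    have hmat : S.Bᵀ * P (Fin.last d) * (S.A - S.B * K) +
        S.Bbarᵀ * P 0 * (S.Abar - S.Bbar * K) - R * K = 0 := by
      have := gainWeight_mul_gain (S := S) hR hP
      rw [← hK, gainWeight] at this
      rw [Matrix.mul_sub, Matrix.mul_sub]
      simp only [Matrix.add_mul, Matrix.mul_assoc] at this ⊢
      rw [sub_add_sub_comm, ← this]
      abel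
    rw [← Matrix.quadForm_congr_mul, ← Matrix.quadForm_congr_mul, Matrix.mulVec_mulVec,
      ← dotProduct_add, ← Matrix.add_mulVec, ← dotProduct_sub, ← Matrix.sub_mulVec, hmat]
    simp
  rw [hA, hAbar, Matrix.quadForm_add hlast, Matrix.quadForm_add hzero, lyapOp_last, gainWeight]
  have hRv : v ⬝ᵥ R *ᵥ v = (-(K *ᵥ x) + u) ⬝ᵥ R *ᵥ (-(K *ᵥ x) + u) := by rw [← hv]
  rw [hRv, Matrix.quadForm_add hR.posSemidef.transpose_eq]
  simp only [Matrix.add_mulVec, dotProduct_add, Matrix.quadForm_congr_mul, Matrix.mulVec_neg,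
    dotProduct_neg, neg_dotProduct, neg_neg]
  linarith

/-- Policy improvement. Only the last component depends on the gain, and there the two sides differ
by the square left over in `quadForm_complete_square` at `v = -K x`. -/
theorem lyapOp_gain_le (hR : R.PosDef) {P : Fin (d + 1) → Matrix (Fin n) (Fin n) ℝ}
    (hP : 0 ≤ P) (K : Matrix (Fin m) (Fin n) ℝ) :
    S.lyapOp d (S.gain R P) P + runCost d Q R (S.gain R P) ≤
      S.lyapOp d K P + runCost d Q R K := by
  intro i
  refine Fin.lastCases ?_ (fun i => ?_) i
  · have hsymm : ∀ K, ((S.lyapOp d K P (Fin.last d) + Kᵀ * R * K)).PosSemidef := fun K =>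
      (Matrix.nonneg_iff_posSemidef.1 (congrOp_nonneg hP _)).add (hR.posSemidef.congr_mul K)
    simp only [Pi.add_apply, runCost, Fin.lastCases_last, ← add_assoc]
    refine add_le_add_left (Matrix.le_iff.2 (Matrix.posSemidef_iff_real.2 ⟨?_, fun x => ?_⟩)) _
    · rw [Matrix.transpose_sub, (hsymm _).transpose_eq, (hsymm _).transpose_eq]
    · have h1 := quadForm_complete_square (S := S) hR hP x (-(K *ᵥ x))
      have h2 := (gainWeight_posDef (S := S) hR hP).posSemidef.quadForm_nonneg
        (-(K *ᵥ x) + S.gain R P *ᵥ x)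
      have hA : S.A *ᵥ x + S.B *ᵥ (-(K *ᵥ x)) = (S.A - S.B * K) *ᵥ x := by
        rw [Matrix.sub_mulVec, Matrix.mulVec_neg, Matrix.mulVec_mulVec]; abel
      have hAbar : S.Abar *ᵥ x + S.Bbar *ᵥ (-(K *ᵥ x)) = (S.Abar - S.Bbar * K) *ᵥ x := by
        rw [Matrix.sub_mulVec, Matrix.mulVec_neg, Matrix.mulVec_mulVec]; abel
      rw [hA, hAbar, Matrix.mulVec_neg, dotProduct_neg, neg_dotProduct, neg_neg] at h1
      rw [Matrix.sub_mulVec, dotProduct_sub, lyapOp_last (K := K)]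
      simp only [Matrix.add_mulVec, dotProduct_add, Matrix.quadForm_congr_mul] at h1 ⊢
      linarith
  · simp [lyapOp_castSucc, runCost]

end NoisySystem

/-! ### Policy iteration and the Riccati-type equations -/

namespace NoisySystem

variable {n m d : ℕ} {S : NoisySystem n m} {Q : Matrix (Fin n) (Fin n) ℝ}
  {R : Matrix (Fin m) (Fin m) ℝ}

theorem contracting_of_lyapunov_le (hobs : S.GramObservable Q) (hQ : Q.PosSemidef) (hR : R.PosDef)
    {K : Matrix (Fin m) (Fin n) ℝ} {P : Fin (d + 1) → Matrix (Fin n) (Fin n) ℝ} (hP : 0 ≤ P)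
    (h : S.lyapOp d K P + runCost d Q R K ≤ P) : Contracting (S.lyapOp d K) :=
  contracting_of_supersolution (runCost_nonneg hQ hR K)
    (fun D hD hle => hobs.posDef hQ hR D hD hle) hP h

theorem exists_posDef_lyapunov (hobs : S.GramObservable Q) (hQ : Q.PosSemidef) (hR : R.PosDef)
    {K : Matrix (Fin m) (Fin n) ℝ} (hK : Contracting (S.lyapOp d K)) :
    ∃ P : Fin (d + 1) → Matrix (Fin n) (Fin n) ℝ, (∀ i, (P i).PosDef) ∧ S.LyapunovEqs Q R K P := by
  obtain ⟨P, hP, -⟩ := existsUnique_congrOp_add hK (runCost d Q R K)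
  have hP' : P = S.lyapOp d K P + runCost d Q R K := hP
  have hle : S.lyapOp d K P ≤ P := by
    nth_rewrite 2 [hP']
    exact le_add_of_nonneg_right (runCost_nonneg hQ hR K)
  exact ⟨P, hobs.posDef hQ hR P (nonneg_of_congrOp_le hK hle) hP'.ge, S.lyapunovEqs_iff.2 hP'⟩

theorem lyapunovEqs_unique {K : Matrix (Fin m) (Fin n) ℝ} (hK : Contracting (S.lyapOp d K))
    {P P' : Fin (d + 1) → Matrix (Fin n) (Fin n) ℝ} (hP : S.LyapunovEqs Q R K P)
    (hP' : S.LyapunovEqs Q R K P') : P = P' :=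
  (existsUnique_congrOp_add hK (runCost d Q R K)).unique (S.lyapunovEqs_iff.1 hP)
    (S.lyapunovEqs_iff.1 hP')

theorem family_nonneg {P : Fin (d + 1) → Matrix (Fin n) (Fin n) ℝ} (hP : ∀ i, (P i).PosDef) :
    0 ≤ P := fun i => Matrix.nonneg_iff_posSemidef.2 (hP i).posSemidef

/-- The engine of the iteration: the old solution is a supersolution for the improved gain, which
yields both contraction of the new operator and monotonicity. -/
theorem lyapunov_gain_le (hR : R.PosDef) {K : Matrix (Fin m) (Fin n) ℝ}
    {P : Fin (d + 1) → Matrix (Fin n) (Fin n) ℝ} (hP : 0 ≤ P) (h : S.LyapunovEqs Q R K P) :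
    S.lyapOp d (S.gain R P) P + runCost d Q R (S.gain R P) ≤ P :=
  (lyapOp_gain_le hR hP K).trans (S.lyapunovEqs_iff.1 h).ge

/-- Subsolutions of the Lyapunov equations lie below solutions when the gain is contracting. -/
theorem le_of_lyapunov {K : Matrix (Fin m) (Fin n) ℝ} (hK : Contracting (S.lyapOp d K))
    {P P' : Fin (d + 1) → Matrix (Fin n) (Fin n) ℝ}
    (hP : S.lyapOp d K P + runCost d Q R K ≤ P)
    (hP' : P' ≤ S.lyapOp d K P' + runCost d Q R K) : P' ≤ P := by
  refine sub_nonneg.1 (nonneg_of_congrOp_le hK ?_)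
  change S.lyapOp d K (P - P') ≤ P - P'
  rw [map_sub]
  have := sub_le_sub hP hP'
  rwa [add_sub_add_right_eq_sub] at this

theorem IsPolicyIteration.contracting (hobs : S.GramObservable Q) (hQ : Q.PosSemidef)
    (hR : R.PosDef) {K0 : Matrix (Fin m) (Fin n) ℝ} (hK0 : Contracting (S.lyapOp d K0))
    {K : ℕ → Matrix (Fin m) (Fin n) ℝ} {P : ℕ → Fin (d + 1) → Matrix (Fin n) (Fin n) ℝ}
    (h : S.IsPolicyIteration Q R K0 K P) (j : ℕ) : Contracting (S.lyapOp d (K j)) := by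
  cases j with
  | zero => rw [h.init]; exact hK0
  | succ j =>
    rw [h.update]
    exact contracting_of_lyapunov_le hobs hQ hR (family_nonneg (h.posDef j))
      (lyapunov_gain_le hR (family_nonneg (h.posDef j)) (h.lyapunov j))

theorem IsPolicyIteration.antitone (hobs : S.GramObservable Q) (hQ : Q.PosSemidef)
    (hR : R.PosDef) {K0 : Matrix (Fin m) (Fin n) ℝ} (hK0 : Contracting (S.lyapOp d K0))
    {K : ℕ → Matrix (Fin m) (Fin n) ℝ} {P : ℕ → Fin (d + 1) → Matrix (Fin n) (Fin n) ℝ}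
    (h : S.IsPolicyIteration Q R K0 K P) (j : ℕ) : P (j + 1) ≤ P j := by
  refine le_of_lyapunov (h.contracting hobs hQ hR hK0 (j + 1)) (Q := Q) (R := R) ?_
    (S.lyapunovEqs_iff.1 (h.lyapunov (j + 1))).le
  rw [h.update]
  exact lyapunov_gain_le hR (family_nonneg (h.posDef j)) (h.lyapunov j)

/-- The recursion runs on the subtype of contracting gains, where each Lyapunov equation has exactly
one solution and the update stays in the subtype. -/
theorem existsUnique_policyIteration (hobs : S.GramObservable Q) (hQ : Q.PosSemidef)
    (hR : R.PosDef) {K0 : Matrix (Fin m) (Fin n) ℝ} (hK0 : Contracting (S.lyapOp d K0)) :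
    ∃! KP : (ℕ → Matrix (Fin m) (Fin n) ℝ) × (ℕ → Fin (d + 1) → Matrix (Fin n) (Fin n) ℝ),
      S.IsPolicyIteration Q R K0 KP.1 KP.2 := by
  choose V hVpos hVlyap using fun K : {K // Contracting (S.lyapOp d K)} =>
    exists_posDef_lyapunov hobs hQ hR K.2
  let next : {K // Contracting (S.lyapOp d K)} → {K // Contracting (S.lyapOp d K)} := fun K =>
    ⟨S.gain R (V K), contracting_of_lyapunov_le hobs hQ hR (family_nonneg (hVpos K))
      (lyapunov_gain_le hR (family_nonneg (hVpos K)) (hVlyap K))⟩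
  let seq : ℕ → {K // Contracting (S.lyapOp d K)} := fun j => next^[j] ⟨K0, hK0⟩
  have hseq : S.IsPolicyIteration Q R K0 (fun j => (seq j).1) fun j => V (seq j) :=
    { init := rfl
      posDef := fun j => hVpos _
      lyapunov := fun j => hVlyap _
      update := fun j => by simp only [seq, Function.iterate_succ_apply', next] }
  refine ⟨(_, _), hseq, ?_⟩
  rintro ⟨K, P⟩ (h : S.IsPolicyIteration Q R K0 K P)
  have hP : ∀ j, K j = (seq j).1 → P j = V (seq j) := fun j hj =>
    lyapunovEqs_unique (seq j).2 (Q := Q) (R := R) (hj ▸ h.lyapunov j) (hVlyap _)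
  have hK : ∀ j, K j = (seq j).1 := fun j => by
    induction j with
    | zero => exact h.init
    | succ j ih => rw [h.update, hP j ih, hseq.update]
  exact Prod.ext (funext hK) (funext fun j => hP j (hK j))

theorem IsRiccatiSolution.contracting (hobs : S.GramObservable Q) (hQ : Q.PosSemidef)
    (hR : R.PosDef) {K : Matrix (Fin m) (Fin n) ℝ} {P : Fin (d + 1) → Matrix (Fin n) (Fin n) ℝ}
    (h : S.IsRiccatiSolution Q R K P) : Contracting (S.lyapOp d K) :=
  contracting_of_lyapunov_le hobs hQ hR (family_nonneg h.posDef) (S.lyapunovEqs_iff.1 h.lyapunov).ge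

/-- Each gain minimizes the right-hand side for its own `P'`, so `P'` is a subsolution for any other
gain `K` and lies below the solution for `K`. Exchanging the roles gives equality. -/
theorem IsRiccatiSolution.unique (hobs : S.GramObservable Q) (hQ : Q.PosSemidef) (hR : R.PosDef)
    {K K' : Matrix (Fin m) (Fin n) ℝ} {P P' : Fin (d + 1) → Matrix (Fin n) (Fin n) ℝ}
    (h : S.IsRiccatiSolution Q R K P) (h' : S.IsRiccatiSolution Q R K' P') : K = K' ∧ P = P' := by
  have hle : ∀ {K K' : Matrix (Fin m) (Fin n) ℝ}
      {P P' : Fin (d + 1) → Matrix (Fin n) (Fin n) ℝ}, S.IsRiccatiSolution Q R K P →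
      S.IsRiccatiSolution Q R K' P' → P' ≤ P := fun {K K' P P'} h h' => by
    refine le_of_lyapunov (h.contracting hobs hQ hR) (S.lyapunovEqs_iff.1 h.lyapunov).ge ?_
    refine (S.lyapunovEqs_iff.1 h'.lyapunov).le.trans ?_
    rw [h'.gain_eq]
    exact lyapOp_gain_le hR (family_nonneg h'.posDef) K
  have hP : P = P' := le_antisymm (hle h' h) (hle h h')
  exact ⟨by rw [h.gain_eq, h'.gain_eq, hP], hP⟩

theorem tendsto_gain (hR : R.PosDef) {P : ℕ → Fin (d + 1) → Matrix (Fin n) (Fin n) ℝ}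
    {M : Fin (d + 1) → Matrix (Fin n) (Fin n) ℝ} (hM : 0 ≤ M)
    (h : Tendsto P atTop (𝓝 M)) : Tendsto (fun j => S.gain R (P j)) atTop (𝓝 (S.gain R M)) := by
  have hw : Continuous fun P : Fin (d + 1) → Matrix (Fin n) (Fin n) ℝ => S.gainWeight R P := by
    unfold gainWeight; fun_prop
  have hN : Continuous fun P : Fin (d + 1) → Matrix (Fin n) (Fin n) ℝ =>
      S.Bᵀ * P (Fin.last d) * S.A + S.Bbarᵀ * P 0 * S.Abar := by fun_prop
  have hdet : (S.gainWeight R M).det ≠ 0 := (gainWeight_posDef hR hM).det_pos.ne'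
  have hinv : ContinuousAt (fun N : Matrix (Fin m) (Fin m) ℝ => N⁻¹) (S.gainWeight R M) :=
    continuousAt_matrix_inv _ (NormedRing.inverse_continuousAt (Units.mk0 _ hdet))
  have hmul : Continuous fun p : Matrix (Fin m) (Fin m) ℝ × Matrix (Fin m) (Fin n) ℝ =>
      p.1 * p.2 := by fun_prop
  exact (hmul.tendsto _).comp
    ((hinv.tendsto.comp ((hw.tendsto M).comp h)).prodMk_nhds ((hN.tendsto M).comp h))

/-- Policy iteration converges to a positive definite solution of the Riccati-type equations. -/
theorem IsPolicyIteration.exists_limit (hobs : S.GramObservable Q) (hQ : Q.PosSemidef)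
    (hR : R.PosDef) {K0 : Matrix (Fin m) (Fin n) ℝ} (hK0 : Contracting (S.lyapOp d K0))
    {K : ℕ → Matrix (Fin m) (Fin n) ℝ} {P : ℕ → Fin (d + 1) → Matrix (Fin n) (Fin n) ℝ}
    (h : S.IsPolicyIteration Q R K0 K P) :
    ∃ (Kopt : Matrix (Fin m) (Fin n) ℝ) (Popt : Fin (d + 1) → Matrix (Fin n) (Fin n) ℝ),
      S.IsRiccatiSolution Q R Kopt Popt ∧ (∀ i, Tendsto (fun j => P j i) atTop (𝓝 (Popt i))) ∧
      Tendsto K atTop (𝓝 Kopt) := by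
  have hlim : ∀ i, ∃ M, Tendsto (fun j => P j i) atTop (𝓝 M) := fun i =>
    Matrix.exists_tendsto_of_antitone (fun j => (h.posDef j i).posSemidef)
      fun j => h.antitone hobs hQ hR hK0 j i
  choose M hM using hlim
  have hM0 : 0 ≤ M := fun i => Matrix.nonneg_iff_posSemidef.2 <|
    Matrix.posSemidef_of_tendsto (hM i) (Eventually.of_forall fun j => (h.posDef j i).posSemidef)
  have hPM : Tendsto P atTop (𝓝 M) := tendsto_pi_nhds.2 hM
  have hKM : Tendsto K atTop (𝓝 (S.gain R M)) := by
    -- Only the gains after the first are given by the update formula.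
    refine (tendsto_add_atTop_iff_nat 1).1 ?_
    simp only [h.update]
    exact tendsto_gain hR hM0 hPM
  have hlyap : S.LyapunovEqs Q R (S.gain R M) M := by
    refine ⟨fun i => ?_, ?_⟩
    · have hc : Continuous fun P : Fin (d + 1) → Matrix (Fin n) (Fin n) ℝ =>
          S.Aᵀ * P i.succ * S.A + S.Abarᵀ * P 0 * S.Abar + Q := by fun_prop
      exact tendsto_nhds_unique (hM _) (((hc.tendsto M).comp hPM).congr fun j =>
        ((h.lyapunov j).1 i).symm)
    · have hc : Continuous fun p : Matrix (Fin m) (Fin n) ℝ ×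
          (Fin (d + 1) → Matrix (Fin n) (Fin n) ℝ) =>
          (S.A - S.B * p.1)ᵀ * p.2 (Fin.last d) * (S.A - S.B * p.1) +
          (S.Abar - S.Bbar * p.1)ᵀ * p.2 0 * (S.Abar - S.Bbar * p.1) + p.1ᵀ * R * p.1 + Q := by
        fun_prop
      exact tendsto_nhds_unique (hM _)
        (((hc.tendsto (S.gain R M, M)).comp (hKM.prodMk_nhds hPM)).congr fun j =>
          (h.lyapunov j).2.symm)
  exact ⟨S.gain R M, M, ⟨hobs.posDef hQ hR M hM0 (S.lyapunovEqs_iff.1 hlyap).ge, hlyap, rfl⟩,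
    hM, hKM⟩

end NoisySystem

/-! ### Square-integrable vectors and orthogonality to the past -/

section SquareIntegrable

variable {Ω : Type*} {m0 : MeasurableSpace Ω} {μ : Measure Ω} {ν κ : Type*} [Fintype ν] [Fintype κ]

/-- Square-integrable random vectors that are measurable, up to null sets, for a sub-σ-algebra. -/
structure SqAdapted (μ : Measure Ω) (𝓖 : MeasurableSpace Ω) (f : Ω → ν → ℝ) : Prop where
  meas : AEStronglyMeasurable[𝓖] f μ
  memLp : MemLp f 2 μ

variable {𝓖 𝓗 : MeasurableSpace Ω}

theorem SqAdapted.congr {f g : Ω → ν → ℝ} (hf : SqAdapted μ 𝓖 f) (h : f =ᵐ[μ] g) :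
    SqAdapted μ 𝓖 g :=
  ⟨hf.meas.congr h, hf.memLp.ae_eq h⟩

theorem SqAdapted.mono {f : Ω → ν → ℝ} (hf : SqAdapted μ 𝓖 f) (h : 𝓖 ≤ 𝓗) : SqAdapted μ 𝓗 f :=
  ⟨hf.meas.mono h, hf.memLp⟩

theorem SqAdapted.const [IsFiniteMeasure μ] (c : ν → ℝ) : SqAdapted μ 𝓖 fun _ => c :=
  ⟨aestronglyMeasurable_const, memLp_const c⟩

theorem SqAdapted.add {f g : Ω → ν → ℝ} (hf : SqAdapted μ 𝓖 f) (hg : SqAdapted μ 𝓖 g) :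
    SqAdapted μ 𝓖 fun ω => f ω + g ω :=
  ⟨hf.meas.add hg.meas, hf.memLp.add hg.memLp⟩

theorem MeasureTheory.MemLp.mulVec {f : Ω → ν → ℝ} (hf : MemLp f 2 μ) (M : Matrix κ ν ℝ) :
    MemLp (fun ω => M *ᵥ f ω) 2 μ :=
  (Matrix.mulVecLin M).toContinuousLinearMap.comp_memLp' hf

theorem SqAdapted.mulVec {f : Ω → ν → ℝ} (hf : SqAdapted μ 𝓖 f) (M : Matrix κ ν ℝ) :
    SqAdapted μ 𝓖 fun ω => M *ᵥ f ω :=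
  ⟨(Matrix.mulVecLin M).toContinuousLinearMap.continuous.comp_aestronglyMeasurable hf.meas,
    hf.memLp.mulVec M⟩

theorem SqAdapted.neg {f : Ω → ν → ℝ} (hf : SqAdapted μ 𝓖 f) : SqAdapted μ 𝓖 fun ω => -f ω :=
  ⟨hf.meas.neg, hf.memLp.neg⟩

theorem SqAdapted.condExp [IsFiniteMeasure μ] {f : Ω → ν → ℝ} (hf : MemLp f 2 μ) :
    SqAdapted μ 𝓖 (μ[f | 𝓖]) :=
  ⟨stronglyMeasurable_condExp.aestronglyMeasurable, hf.condExp one_le_two⟩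

theorem integrable_bilin {f : Ω → ν → ℝ} {g : Ω → κ → ℝ} (hf : MemLp f 2 μ) (hg : MemLp g 2 μ)
    (M : Matrix ν κ ℝ) : Integrable (fun ω => f ω ⬝ᵥ M *ᵥ g ω) μ := by
  simp only [dotProduct]
  exact integrable_finsetSum _ fun i _ => (hf.eval i).integrable_mul ((hg.mulVec M).eval i)

theorem aestronglyMeasurable_bilin {f : Ω → ν → ℝ} {g : Ω → κ → ℝ} (hf : SqAdapted μ 𝓖 f)
    (hg : SqAdapted μ 𝓖 g) (M : Matrix ν κ ℝ) :
    AEStronglyMeasurable[𝓖] (fun ω => f ω ⬝ᵥ M *ᵥ g ω) μ := by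
  have hc : Continuous fun p : (ν → ℝ) × (κ → ℝ) => p.1 ⬝ᵥ M *ᵥ p.2 := by fun_prop
  exact hc.comp_aestronglyMeasurable (hf.meas.prodMk hg.meas)

/-- A random vector with vanishing conditional expectation is orthogonal to the past. -/
theorem integral_bilin_eq_zero (h𝓖 : 𝓖 ≤ m0) [IsFiniteMeasure μ]
    {f : Ω → ν → ℝ} {g : Ω → κ → ℝ} (hf : MemLp f 2 μ)
    (hf0 : μ[f | 𝓖] =ᵐ[μ] 0) (hg : SqAdapted μ 𝓖 g) (M : Matrix ν κ ℝ) :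
    ∫ ω, f ω ⬝ᵥ M *ᵥ g ω ∂μ = 0 := by
  classical
  let B : (ν → ℝ) →L[ℝ] (κ → ℝ) →L[ℝ] ℝ := (Matrix.toLinearMap₂' ℝ M).toContinuousBilinearMap
  have hB : ∀ x y, B x y = x ⬝ᵥ M *ᵥ y := fun x y => by
    simp [B, Matrix.toLinearMap₂'_apply']
  have hint := integrable_bilin hf hg.memLp M
  have h := condExp_bilin_of_aestronglyMeasurable_right B (m := 𝓖) (f := f) hg.meas
    (by simpa only [hB] using hint) (hf.integrable one_le_two)
  simp only [hB] at h
  rw [← integral_condExp h𝓖, integral_congr_ae h]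
  refine integral_eq_zero_of_ae ?_
  filter_upwards [hf0] with ω hω
  simp [hω]

/-- Pythagoras for conditional expectations, with a quadratic form and an affine perturbation that
belongs to the past. -/
theorem integral_quadForm_condExp (h𝓖 : 𝓖 ≤ m0) [IsFiniteMeasure μ]
    {f g : Ω → ν → ℝ} {l : ℕ} {v : Ω → Fin l → ℝ} (hf : MemLp f 2 μ) (hg : g =ᵐ[μ] μ[f | 𝓖])
    (hv : SqAdapted μ 𝓖 v) (C : Matrix κ ν ℝ) (D : Matrix κ (Fin l) ℝ) (P : Matrix κ κ ℝ) :
    ∫ ω, (C *ᵥ f ω + D *ᵥ v ω) ⬝ᵥ P *ᵥ (C *ᵥ f ω + D *ᵥ v ω) ∂μ =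
      (∫ ω, (f ω - g ω) ⬝ᵥ (Cᵀ * P * C) *ᵥ (f ω - g ω) ∂μ) +
      ∫ ω, (C *ᵥ g ω + D *ᵥ v ω) ⬝ᵥ P *ᵥ (C *ᵥ g ω + D *ᵥ v ω) ∂μ := by
  have hgs : SqAdapted μ 𝓖 g := (SqAdapted.condExp hf).congr hg.symm
  have hd : MemLp (fun ω => f ω - g ω) 2 μ := hf.sub hgs.memLp
  have hd0 : μ[fun ω => f ω - g ω | 𝓖] =ᵐ[μ] 0 := by
    have h1 := condExp_sub (hf.integrable one_le_two) (hgs.memLp.integrable one_le_two) 𝓖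
    have h2 := condExp_of_aestronglyMeasurable' h𝓖 hgs.meas (hgs.memLp.integrable one_le_two)
    refine h1.trans ?_
    filter_upwards [h2, hg] with ω h2 hg
    simp [h2, hg]
  set z : Ω → κ → ℝ := fun ω => C *ᵥ g ω + D *ᵥ v ω with hz
  have hzs : SqAdapted μ 𝓖 z := (hgs.mulVec C).add (hv.mulVec D)
  -- The two cross terms are kept apart, with `P` and `Pᵀ`, because `P` is not assumed symmetric;
  -- each integrates to zero.
  have hexp : ∀ ω, (C *ᵥ f ω + D *ᵥ v ω) ⬝ᵥ P *ᵥ (C *ᵥ f ω + D *ᵥ v ω) =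
      ((f ω - g ω) ⬝ᵥ (Cᵀ * P * C) *ᵥ (f ω - g ω) + (f ω - g ω) ⬝ᵥ (Cᵀ * P) *ᵥ z ω +
        (f ω - g ω) ⬝ᵥ (Cᵀ * Pᵀ) *ᵥ z ω) + z ω ⬝ᵥ P *ᵥ z ω := fun ω => by
    have h1 : C *ᵥ f ω + D *ᵥ v ω = C *ᵥ (f ω - g ω) + z ω := by
      simp only [hz, Matrix.mulVec_sub]; abel
    have h2 : ∀ N : Matrix κ κ ℝ, (f ω - g ω) ⬝ᵥ (Cᵀ * N) *ᵥ z ω =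
        (C *ᵥ (f ω - g ω)) ⬝ᵥ N *ᵥ z ω := fun N => by
      rw [← Matrix.mulVec_mulVec, Matrix.dotProduct_mulVec, Matrix.vecMul_transpose]
    rw [h1, Matrix.quadForm_congr_mul, h2, h2, Matrix.mulVec_add, add_dotProduct, dotProduct_add,
      dotProduct_add, Matrix.mulVec_transpose, ← dotProduct_comm (z ω ᵥ* P),
      ← Matrix.dotProduct_mulVec]
    ring
  simp_rw [hexp]
  have i1 := integrable_bilin hd hd (Cᵀ * P * C)
  have i2 := integrable_bilin hd hzs.memLp (Cᵀ * P)
  have i3 := integrable_bilin hd hzs.memLp (Cᵀ * Pᵀ)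
  have i4 := integrable_bilin hzs.memLp hzs.memLp P
  have i12 : Integrable (fun ω => (f ω - g ω) ⬝ᵥ (Cᵀ * P * C) *ᵥ (f ω - g ω) +
      (f ω - g ω) ⬝ᵥ (Cᵀ * P) *ᵥ z ω) μ := i1.add i2
  have i123 : Integrable (fun ω => (f ω - g ω) ⬝ᵥ (Cᵀ * P * C) *ᵥ (f ω - g ω) +
      (f ω - g ω) ⬝ᵥ (Cᵀ * P) *ᵥ z ω + (f ω - g ω) ⬝ᵥ (Cᵀ * Pᵀ) *ᵥ z ω) μ := i12.add i3
  rw [integral_add i123 i4, integral_add i12 i3, integral_add i1 i2,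
    integral_bilin_eq_zero h𝓖 hd hd0 hzs, integral_bilin_eq_zero h𝓖 hd hd0 hzs, add_zero, add_zero]

end SquareIntegrable

/-! ### Second moments of the white noise -/

section Noise

variable {Ω : Type*} {m0 : MeasurableSpace Ω} {μ : Measure Ω} {w : ℕ → Ω → ℝ}

theorem pastSigma_mono (w : ℕ → Ω → ℝ) {k l : ℕ} (h : k ≤ l) : pastSigma w k ≤ pastSigma w l :=
  iSup_le fun i => le_iSup (fun i : Fin l => MeasurableSpace.comap (w i) inferInstance)
    (Fin.castLE h i)

theorem measurable_pastSigma_succ (w : ℕ → Ω → ℝ) (k : ℕ) : Measurable[pastSigma w (k + 1)] (w k) :=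
  Measurable.mono (comap_measurable (w k))
    (le_iSup (fun i : Fin (k + 1) => MeasurableSpace.comap (w i) inferInstance) (Fin.last k)) le_rfl

namespace IsWhiteNoise

theorem past_le (hw : IsWhiteNoise μ w) (k : ℕ) : pastSigma w k ≤ m0 :=
  iSup_le fun i => (hw.measurable i).comap_le

variable [IsProbabilityMeasure μ] {n : ℕ}

/-- Unit conditional variance says that `w_k² μ` and `μ` agree on past events. Working with
`lintegral` avoids assuming integrability of the product, which is what `memLp_smul` has to prove.
-/
theorem lintegral_sq_mul (hw : IsWhiteNoise μ w) (k : ℕ) {g : Ω → ENNReal}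
    (hg : Measurable[pastSigma w k] g) :
    ∫⁻ ω, ENNReal.ofReal (w k ω ^ 2) * g ω ∂μ = ∫⁻ ω, g ω ∂μ := by
  have hm := hw.past_le k
  have hsq : Measurable fun ω => ENNReal.ofReal (w k ω ^ 2) :=
    ((hw.measurable k).pow_const 2).ennreal_ofReal
  have hint : Integrable (fun ω => w k ω ^ 2) μ := (hw.memLp k).integrable_sq
  have htrim : (μ.withDensity fun ω => ENNReal.ofReal (w k ω ^ 2)).trim hm = μ.trim hm := by
    refine @Measure.ext _ (pastSigma w k) _ _ fun s hs => ?_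
    rw [trim_measurableSet_eq hm hs, trim_measurableSet_eq hm hs, withDensity_apply _ (hm s hs),
      ← ofReal_integral_eq_lintegral_ofReal hint.integrableOn
        (Eventually.of_forall fun ω => sq_nonneg _), ← setIntegral_condExp hm hint hs,
      setIntegral_congr_ae (hm s hs) ((hw.unit_variance k).mono fun ω h _ => h)]
    simp
  have h1 := lintegral_trim (μ := μ.withDensity fun ω => ENNReal.ofReal (w k ω ^ 2)) hm hg
  rw [htrim, lintegral_trim hm hg, lintegral_withDensity_eq_lintegral_mul _ hsq
    (hg.mono hm le_rfl)] at h1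
  exact h1.symm

theorem memLp_smul (hw : IsWhiteNoise μ w) (k : ℕ) {f : Ω → Fin n → ℝ}
    (hf : SqAdapted μ (pastSigma w k) f) : MemLp (fun ω => w k ω • f ω) 2 μ := by
  have hfm := hf.meas.mono (hw.past_le k)
  have hmeas : AEStronglyMeasurable (fun ω => w k ω • f ω) μ :=
    (hw.measurable k).aestronglyMeasurable.smul hfm
  refine (memLp_two_iff_integrable_sq_norm hmeas).2 ?_
  have hfi := (memLp_two_iff_integrable_sq_norm hfm).1 hf.memLp
  refine ⟨hmeas.norm.pow 2, ?_⟩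
  obtain ⟨g, hg, hfg⟩ := hf.meas
  have hgm : Measurable[pastSigma w k] fun ω => ENNReal.ofReal (‖g ω‖ ^ 2) :=
    (hg.norm.measurable.pow_const 2).ennreal_ofReal
  have hle : ∫⁻ ω, ‖‖w k ω • f ω‖ ^ 2‖ₑ ∂μ = ∫⁻ ω, ‖‖f ω‖ ^ 2‖ₑ ∂μ := by
    calc _ = ∫⁻ ω, ENNReal.ofReal (w k ω ^ 2) * ENNReal.ofReal (‖g ω‖ ^ 2) ∂μ := by
          refine lintegral_congr_ae ?_
          filter_upwards [hfg] with ω hω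
          rw [Real.enorm_of_nonneg (by positivity), norm_smul, mul_pow,
            ENNReal.ofReal_mul (by positivity), hω, Real.norm_eq_abs, sq_abs]
      _ = ∫⁻ ω, ENNReal.ofReal (‖g ω‖ ^ 2) ∂μ := hw.lintegral_sq_mul k hgm
      _ = _ := by
          refine lintegral_congr_ae ?_
          filter_upwards [hfg] with ω hω
          rw [Real.enorm_of_nonneg (by positivity), hω]
  rw [HasFiniteIntegral, hle]
  exact hfi.2

theorem condExp_smul (hw : IsWhiteNoise μ w) (k : ℕ) {f : Ω → Fin n → ℝ}
    (hf : SqAdapted μ (pastSigma w k) f) :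
    μ[fun ω => w k ω • f ω | pastSigma w k] =ᵐ[μ] 0 := by
  have h := condExp_smul_of_aestronglyMeasurable_right (f := w k) (g := f)
    ((hw.memLp k).integrable one_le_two) ((hw.memLp_smul k hf).integrable one_le_two) hf.meas
  refine h.trans ?_
  filter_upwards [hw.mean_zero k] with ω hω
  simp [hω]

theorem integral_quadForm_smul (hw : IsWhiteNoise μ w) (k : ℕ) {f : Ω → Fin n → ℝ}
    (hf : SqAdapted μ (pastSigma w k) f) (P : Matrix (Fin n) (Fin n) ℝ) :
    ∫ ω, (w k ω • f ω) ⬝ᵥ P *ᵥ (w k ω • f ω) ∂μ = ∫ ω, f ω ⬝ᵥ P *ᵥ f ω ∂μ := by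
  have hq : ∀ ω, (w k ω • f ω) ⬝ᵥ P *ᵥ (w k ω • f ω) = w k ω ^ 2 * (f ω ⬝ᵥ P *ᵥ f ω) := fun ω => by
    rw [Matrix.mulVec_smul, smul_dotProduct, dotProduct_smul, smul_eq_mul, smul_eq_mul]; ring
  have hi := integrable_bilin (hw.memLp_smul k hf) (hw.memLp_smul k hf) P
  simp_rw [hq] at hi ⊢
  have h := condExp_mul_of_aestronglyMeasurable_right (f := fun ω => w k ω ^ 2)
    (aestronglyMeasurable_bilin hf hf P) hi (hw.memLp k).integrable_sq
  rw [← integral_condExp (hw.past_le k)]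
  refine integral_congr_ae (h.trans ?_)
  filter_upwards [hw.unit_variance k] with ω hω
  simp [hω]

end IsWhiteNoise

end Noise

/-! ### Predictors, innovations and the evolution of the energy -/

namespace NoisySystem

variable {n m d : ℕ} {Ω : Type*} (S : NoisySystem n m)

theorem step_eq (r : ℝ) (x : Fin n → ℝ) (v : Fin m → ℝ) :
    S.step r x v = (S.A *ᵥ x + S.B *ᵥ v) + r • (S.Abar *ᵥ x + S.Bbar *ᵥ v) := by
  simp only [step, Matrix.add_mulVec, Matrix.smul_mulVec, smul_add]
  abel

theorem state_succ (w : ℕ → Ω → ℝ) (x0 : Fin n → ℝ) (v : ℕ → Ω → Fin m → ℝ) (k : ℕ) :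
    S.state w x0 v (k + 1) = fun ω => (S.A *ᵥ S.state w x0 v k ω + S.B *ᵥ v k ω) +
      w k ω • (S.Abar *ᵥ S.state w x0 v k ω + S.Bbar *ᵥ v k ω) :=
  funext fun _ => S.step_eq _ _ _

variable [m0 : MeasurableSpace Ω]

/-- The predictor `E[x_k | ℱ_{k-i-1}]`. -/
noncomputable def pred (μ : Measure Ω) (w : ℕ → Ω → ℝ) (x0 : Fin n → ℝ) (v : ℕ → Ω → Fin m → ℝ)
    (k i : ℕ) : Ω → Fin n → ℝ :=
  μ[S.state w x0 v k | pastSigma w (k - i)]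

/-- The innovation `E[x_k | ℱ_{k-i-1}] - E[x_k | ℱ_{k-i-2}]`. -/
noncomputable def innov (μ : Measure Ω) (w : ℕ → Ω → ℝ) (x0 : Fin n → ℝ) (v : ℕ → Ω → Fin m → ℝ)
    (k i : ℕ) (ω : Ω) : Fin n → ℝ :=
  S.pred μ w x0 v k i ω - S.pred μ w x0 v k (i + 1) ω

/-- The Lyapunov functional of the delayed system at time `k`. -/
noncomputable def energy (μ : Measure Ω) (w : ℕ → Ω → ℝ) (x0 : Fin n → ℝ)
    (v : ℕ → Ω → Fin m → ℝ) (k : ℕ) (P : Fin (d + 1) → Matrix (Fin n) (Fin n) ℝ) : ℝ :=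
  (∑ i : Fin d, ∫ ω, S.innov μ w x0 v k i ω ⬝ᵥ P i.castSucc *ᵥ S.innov μ w x0 v k i ω ∂μ) +
    ∫ ω, S.pred μ w x0 v k d ω ⬝ᵥ P (Fin.last d) *ᵥ S.pred μ w x0 v k d ω ∂μ

variable {S} {μ : Measure Ω} [IsProbabilityMeasure μ] {w : ℕ → Ω → ℝ} {x0 : Fin n → ℝ}
  {v : ℕ → Ω → Fin m → ℝ}

theorem state_sqAdapted_succ (hw : IsWhiteNoise μ w) {k : ℕ}
    (hx : SqAdapted μ (pastSigma w k) (S.state w x0 v k))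
    (hv : SqAdapted μ (pastSigma w k) (v k)) :
    SqAdapted μ (pastSigma w (k + 1)) (S.state w x0 v (k + 1)) := by
  rw [state_succ]
  have hz := (hx.mulVec S.Abar).add (hv.mulVec S.Bbar)
  refine (((hx.mulVec S.A).add (hv.mulVec S.B)).mono (pastSigma_mono w k.le_succ)).add
    ⟨?_, hw.memLp_smul k hz⟩
  exact (measurable_pastSigma_succ w k).aestronglyMeasurable.smul
    (hz.meas.mono (pastSigma_mono w k.le_succ))

theorem state_sqAdapted (hw : IsWhiteNoise μ w) {K : ℕ}
    (hv : ∀ k < K, SqAdapted μ (pastSigma w (k - d)) (v k)) :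
    ∀ k ≤ K, SqAdapted μ (pastSigma w k) (S.state w x0 v k) := by
  intro k
  induction k with
  | zero => exact fun _ => SqAdapted.const x0
  | succ k ih =>
    exact fun hk => state_sqAdapted_succ hw (ih (by omega))
      ((hv k hk).mono (pastSigma_mono w (Nat.sub_le k d)))

variable (hw : IsWhiteNoise μ w)

section Adapted

variable (hv : ∀ k, SqAdapted μ (pastSigma w (k - d)) (v k))
include hw hv

theorem state_sqAdapted' (k : ℕ) : SqAdapted μ (pastSigma w k) (S.state w x0 v k) :=
  state_sqAdapted hw (fun k _ => hv k) k le_rfl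

theorem pred_sqAdapted (k i : ℕ) :
    SqAdapted μ (pastSigma w (k - i)) (S.pred μ w x0 v k i) :=
  SqAdapted.condExp (state_sqAdapted' hw hv k).memLp

theorem pred_zero (k : ℕ) : S.pred μ w x0 v k 0 =ᵐ[μ] S.state w x0 v k :=
  condExp_of_aestronglyMeasurable' (hw.past_le _) (state_sqAdapted' hw hv k).meas
    ((state_sqAdapted' hw hv k).memLp.integrable one_le_two)

omit hv in
theorem pred_tower (k i : ℕ) :
    S.pred μ w x0 v k (i + 1) =ᵐ[μ] μ[S.pred μ w x0 v k i | pastSigma w (k - (i + 1))] :=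
  (condExp_condExp_of_le (pastSigma_mono w (by omega)) (hw.past_le _)).symm

theorem innov_memLp (k i : ℕ) : MemLp (S.innov μ w x0 v k i) 2 μ :=
  (pred_sqAdapted hw hv k i).memLp.sub (pred_sqAdapted hw hv k (i + 1)).memLp

/-- The noise term has zero conditional expectation given `ℱ_{k-1}`, hence given any smaller past.
The condition `i ≤ d` makes the input `v k` known at the time of prediction, so it passes through
the conditional expectation. -/
theorem pred_succ_succ (k : ℕ) {i : ℕ} (hi : i ≤ d) :
    S.pred μ w x0 v (k + 1) (i + 1) =ᵐ[μ]
      fun ω => S.A *ᵥ S.pred μ w x0 v k i ω + S.B *ᵥ v k ω := by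
  have hx := state_sqAdapted' (S := S) (x0 := x0) hw hv k
  have hvk := (hv k).mono (pastSigma_mono w (Nat.sub_le k d))
  have hvi := (hv k).mono (pastSigma_mono w (show k - d ≤ k - i by omega))
  have hy := (hx.mulVec S.A).add (hvk.mulVec S.B)
  have hz := (hx.mulVec S.Abar).add (hvk.mulVec S.Bbar)
  have hle : pastSigma w (k - i) ≤ pastSigma w k := pastSigma_mono w (Nat.sub_le k i)
  have h1 := condExp_add (hy.memLp.integrable one_le_two)
    ((hw.memLp_smul k hz).integrable one_le_two) (pastSigma w (k - i))
  have h2 := condExp_add ((hx.mulVec S.A).memLp.integrable one_le_two)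
    ((hvk.mulVec S.B).memLp.integrable one_le_two) (pastSigma w (k - i))
  have h3 := (Matrix.mulVecLin S.A).toContinuousLinearMap.comp_condExp_comm
    (m := pastSigma w (k - i)) (hx.memLp.integrable one_le_two)
  have h4 := condExp_of_aestronglyMeasurable' (hw.past_le _) (hvi.mulVec S.B).meas
    ((hvi.mulVec S.B).memLp.integrable one_le_two)
  have h5 : μ[fun ω => w k ω • (S.Abar *ᵥ S.state w x0 v k ω + S.Bbar *ᵥ v k ω) |
      pastSigma w (k - i)] =ᵐ[μ] 0 := by
    refine (condExp_condExp_of_le hle (hw.past_le k)).symm.trans ?_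
    refine (condExp_congr_ae (hw.condExp_smul k hz)).trans ?_
    rw [condExp_zero]
  rw [pred, state_succ, Nat.succ_sub_succ]
  refine h1.trans ?_
  filter_upwards [h2, h3, h4, h5] with ω h2 h3 h4 h5
  rw [Pi.add_apply, h5, Pi.zero_apply, add_zero]
  refine h2.trans ?_
  rw [Pi.add_apply, h4]
  congr 1
  exact h3.symm

theorem innov_succ_zero (k : ℕ) :
    S.innov μ w x0 v (k + 1) 0 =ᵐ[μ]
      fun ω => w k ω • (S.Abar *ᵥ S.state w x0 v k ω + S.Bbar *ᵥ v k ω) := by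
  filter_upwards [pred_zero (S := S) (x0 := x0) hw hv (k + 1),
    pred_succ_succ (S := S) (x0 := x0) hw hv k (Nat.zero_le d),
    pred_zero (S := S) (x0 := x0) hw hv k] with ω h1 h2 h3
  rw [innov, h1, h2, h3, state_succ]
  exact add_sub_cancel_left _ _

theorem innov_succ_succ (k : ℕ) {i : ℕ} (hi : i + 1 ≤ d) :
    S.innov μ w x0 v (k + 1) (i + 1) =ᵐ[μ] fun ω => S.A *ᵥ S.innov μ w x0 v k i ω := by
  filter_upwards [pred_succ_succ (S := S) (x0 := x0) hw hv k (show i ≤ d by omega),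
    pred_succ_succ (S := S) (x0 := x0) hw hv k hi] with ω h1 h2
  rw [innov, h1, h2, innov, Matrix.mulVec_sub]
  abel

/-- Orthogonal decomposition along the innovations. -/
theorem integral_quadForm_innov {κ : Type*} [Fintype κ] (k : ℕ) (C : Matrix κ (Fin n) ℝ)
    (D : Matrix κ (Fin m) ℝ) (P : Matrix κ κ ℝ) (j : ℕ) (hj : j ≤ d) :
    ∫ ω, (C *ᵥ S.state w x0 v k ω + D *ᵥ v k ω) ⬝ᵥ
        P *ᵥ (C *ᵥ S.state w x0 v k ω + D *ᵥ v k ω) ∂μ =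
      (∑ i : Fin j, ∫ ω, S.innov μ w x0 v k i ω ⬝ᵥ (Cᵀ * P * C) *ᵥ S.innov μ w x0 v k i ω ∂μ) +
      ∫ ω, (C *ᵥ S.pred μ w x0 v k j ω + D *ᵥ v k ω) ⬝ᵥ
        P *ᵥ (C *ᵥ S.pred μ w x0 v k j ω + D *ᵥ v k ω) ∂μ := by
  induction j with
  | zero =>
    simp only [Finset.univ_eq_empty, Finset.sum_empty, zero_add]
    refine integral_congr_ae ?_
    filter_upwards [pred_zero (S := S) (x0 := x0) hw hv k] with ω h
    rw [h]
  | succ j ih =>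
    have hvj := (hv k).mono (pastSigma_mono w (show k - d ≤ k - (j + 1) by omega))
    rw [ih (by omega), integral_quadForm_condExp (hw.past_le _)
      (pred_sqAdapted hw hv k j).memLp (pred_tower hw k j) hvj, Fin.sum_univ_castSucc, add_assoc]
    rfl

theorem energy_const (k : ℕ) (P : Matrix (Fin n) (Fin n) ℝ) :
    S.energy (d := d) μ w x0 v k (fun _ => P) =
      ∫ ω, S.state w x0 v k ω ⬝ᵥ P *ᵥ S.state w x0 v k ω ∂μ := by
  have := integral_quadForm_innov (S := S) (x0 := x0) hw hv k 1 0 P d le_rfl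
  simpa [energy] using this.symm

/-- Evolution of the energy under an arbitrary input. -/
theorem energy_succ (hd : 0 < d) (k : ℕ) (P : Fin (d + 1) → Matrix (Fin n) (Fin n) ℝ) :
    S.energy μ w x0 v (k + 1) P =
      (∑ i : Fin d, ∫ ω, S.innov μ w x0 v k i ω ⬝ᵥ
        (S.Aᵀ * P i.succ * S.A + S.Abarᵀ * P 0 * S.Abar) *ᵥ S.innov μ w x0 v k i ω ∂μ) +
      ((∫ ω, (S.A *ᵥ S.pred μ w x0 v k d ω + S.B *ᵥ v k ω) ⬝ᵥ
        P (Fin.last d) *ᵥ (S.A *ᵥ S.pred μ w x0 v k d ω + S.B *ᵥ v k ω) ∂μ) +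
      ∫ ω, (S.Abar *ᵥ S.pred μ w x0 v k d ω + S.Bbar *ᵥ v k ω) ⬝ᵥ
        P 0 *ᵥ (S.Abar *ᵥ S.pred μ w x0 v k d ω + S.Bbar *ᵥ v k ω) ∂μ) := by
  obtain ⟨e, rfl⟩ : ∃ e, d = e + 1 := ⟨d - 1, by omega⟩
  have hi := fun i => innov_memLp (S := S) (x0 := x0) hw hv k i
  have hx := state_sqAdapted' (S := S) (x0 := x0) hw hv k
  have hvk := (hv k).mono (pastSigma_mono w (Nat.sub_le k (e + 1)))
  have hz := (hx.mulVec S.Abar).add (hvk.mulVec S.Bbar)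
  -- The new innovation is `w k` times `Abar x + Bbar v`. Unit variance removes the noise, and the
  -- remaining state is decomposed along the old innovations.
  have hfirst : ∫ ω, S.innov μ w x0 v (k + 1) 0 ω ⬝ᵥ P 0 *ᵥ S.innov μ w x0 v (k + 1) 0 ω ∂μ =
      (∑ i : Fin (e + 1), ∫ ω, S.innov μ w x0 v k i ω ⬝ᵥ (S.Abarᵀ * P 0 * S.Abar) *ᵥ
        S.innov μ w x0 v k i ω ∂μ) +
      ∫ ω, (S.Abar *ᵥ S.pred μ w x0 v k (e + 1) ω + S.Bbar *ᵥ v k ω) ⬝ᵥ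
        P 0 *ᵥ (S.Abar *ᵥ S.pred μ w x0 v k (e + 1) ω + S.Bbar *ᵥ v k ω) ∂μ := by
    rw [← integral_quadForm_innov hw hv k S.Abar S.Bbar (P 0) (e + 1) le_rfl,
      ← hw.integral_quadForm_smul k hz]
    refine integral_congr_ae ?_
    filter_upwards [innov_succ_zero (S := S) (x0 := x0) hw hv k] with ω h
    rw [h]
  have hmid : ∀ i : Fin e, ∫ ω, S.innov μ w x0 v (k + 1) (i + 1) ω ⬝ᵥ
      P i.succ.castSucc *ᵥ S.innov μ w x0 v (k + 1) (i + 1) ω ∂μ =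
      ∫ ω, S.innov μ w x0 v k i ω ⬝ᵥ (S.Aᵀ * P i.castSucc.succ * S.A) *ᵥ
        S.innov μ w x0 v k i ω ∂μ := fun i => by
    refine integral_congr_ae ?_
    filter_upwards [innov_succ_succ (S := S) (x0 := x0) hw hv k
      (show (i : ℕ) + 1 ≤ e + 1 by omega)] with ω h
    rw [h, Matrix.quadForm_congr_mul, Fin.succ_castSucc]
  -- The new depth-`d` predictor is driven by the old one of depth `d - 1`; conditioning once more
  -- splits off the oldest innovation, which is absorbed here.
  have hlast : ∫ ω, S.pred μ w x0 v (k + 1) (e + 1) ω ⬝ᵥ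
      P (Fin.last (e + 1)) *ᵥ S.pred μ w x0 v (k + 1) (e + 1) ω ∂μ =
      (∫ ω, S.innov μ w x0 v k e ω ⬝ᵥ (S.Aᵀ * P (Fin.last (e + 1)) * S.A) *ᵥ
        S.innov μ w x0 v k e ω ∂μ) +
      ∫ ω, (S.A *ᵥ S.pred μ w x0 v k (e + 1) ω + S.B *ᵥ v k ω) ⬝ᵥ
        P (Fin.last (e + 1)) *ᵥ (S.A *ᵥ S.pred μ w x0 v k (e + 1) ω + S.B *ᵥ v k ω) ∂μ := by
    refine Eq.trans ?_ (integral_quadForm_condExp (hw.past_le _)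
      (pred_sqAdapted (S := S) (x0 := x0) hw hv k e).memLp (pred_tower hw k e) (hv k) S.A S.B _)
    refine integral_congr_ae ?_
    filter_upwards [pred_succ_succ (S := S) (x0 := x0) hw hv k (Nat.le_succ e)] with ω h
    rw [h]
  have hsplit : ∀ i : Fin (e + 1), ∫ ω, S.innov μ w x0 v k i ω ⬝ᵥ
        (S.Aᵀ * P i.succ * S.A + S.Abarᵀ * P 0 * S.Abar) *ᵥ S.innov μ w x0 v k i ω ∂μ =
      (∫ ω, S.innov μ w x0 v k i ω ⬝ᵥ (S.Aᵀ * P i.succ * S.A) *ᵥ S.innov μ w x0 v k i ω ∂μ) +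
      ∫ ω, S.innov μ w x0 v k i ω ⬝ᵥ (S.Abarᵀ * P 0 * S.Abar) *ᵥ S.innov μ w x0 v k i ω ∂μ :=
    fun i => by
      simp only [Matrix.add_mulVec, dotProduct_add]
      exact integral_add (integrable_bilin (hi i) (hi i) _) (integrable_bilin (hi i) (hi i) _)
  simp only [hsplit, Finset.sum_add_distrib]
  rw [energy, hlast, Fin.sum_univ_succ]
  simp only [Fin.val_succ, Fin.val_zero, hmid, Fin.castSucc_zero, hfirst]
  rw [Fin.sum_univ_castSucc (f := fun i : Fin (e + 1) => ∫ ω, S.innov μ w x0 v k i ω ⬝ᵥ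
    (S.Aᵀ * P i.succ * S.A) *ᵥ S.innov μ w x0 v k i ω ∂μ)]
  simp only [Fin.val_castSucc, Fin.val_last, Fin.succ_last]
  ring

theorem energy_mono (k : ℕ) {P P' : Fin (d + 1) → Matrix (Fin n) (Fin n) ℝ} (h : P ≤ P') :
    S.energy μ w x0 v k P ≤ S.energy μ w x0 v k P' := by
  have hq : ∀ i x, x ⬝ᵥ P i *ᵥ x ≤ x ⬝ᵥ P' i *ᵥ x := fun i x => by
    have := (Matrix.le_iff.1 (h i)).quadForm_nonneg x
    rw [Matrix.sub_mulVec, dotProduct_sub] at this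
    linarith
  have hi := fun i => innov_memLp (S := S) (x0 := x0) hw hv k i
  have hp := (pred_sqAdapted (S := S) (x0 := x0) hw hv k d).memLp
  refine add_le_add (Finset.sum_le_sum fun i _ => ?_) ?_
  · exact integral_mono (integrable_bilin (hi i) (hi i) _) (integrable_bilin (hi i) (hi i) _)
      fun ω => hq _ _
  · exact integral_mono (integrable_bilin hp hp _) (integrable_bilin hp hp _) fun ω => hq _ _

/-- Under predictor feedback the energy evolves by the Lyapunov operator. -/
theorem energy_succ_feedback (hd : 0 < d) {K : Matrix (Fin m) (Fin n) ℝ} {k : ℕ}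
    (hfb : v k =ᵐ[μ] fun ω => -(K *ᵥ S.pred μ w x0 v k d ω))
    (P : Fin (d + 1) → Matrix (Fin n) (Fin n) ℝ) :
    S.energy μ w x0 v (k + 1) P = S.energy μ w x0 v k (S.lyapOp d K P) := by
  have hp := (pred_sqAdapted (S := S) (x0 := x0) hw hv k d).memLp
  rw [energy_succ hw hv hd, energy]
  simp only [lyapOp_castSucc, lyapOp_last, Matrix.add_mulVec, dotProduct_add]
  congr 1
  rw [integral_add (integrable_bilin hp hp _) (integrable_bilin hp hp _)]
  congr 1 <;>
  · refine integral_congr_ae ?_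
    filter_upwards [hfb] with ω h
    rw [h, Matrix.quadForm_congr_mul, Matrix.sub_mulVec, Matrix.mulVec_neg, Matrix.mulVec_mulVec,
      sub_eq_add_neg]

end Adapted

end NoisySystem

/-! ### Stabilizing gains are the contracting ones; observability by second moments -/

namespace NoisySystem

variable {n m d : ℕ} {Ω : Type*} {S : NoisySystem n m} [m0 : MeasurableSpace Ω]
  {μ : Measure Ω} [IsProbabilityMeasure μ] {w : ℕ → Ω → ℝ} {x0 : Fin n → ℝ}

section Energy

variable {v : ℕ → Ω → Fin m → ℝ} (hw : IsWhiteNoise μ w)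
  (hv : ∀ k, SqAdapted μ (pastSigma w (k - d)) (v k))
include hw hv

theorem energy_add (k : ℕ) (P P' : Fin (d + 1) → Matrix (Fin n) (Fin n) ℝ) :
    S.energy μ w x0 v k (P + P') = S.energy μ w x0 v k P + S.energy μ w x0 v k P' := by
  have hi := fun i => innov_memLp (S := S) (x0 := x0) hw hv k i
  have hp := (pred_sqAdapted (S := S) (x0 := x0) hw hv k d).memLp
  simp only [energy, Pi.add_apply, Matrix.add_mulVec, dotProduct_add]
  rw [integral_add (integrable_bilin hp hp _) (integrable_bilin hp hp _),
    Finset.sum_congr rfl fun (i : Fin d) _ => integral_add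
      (integrable_bilin (hi i) (hi i) (P i.castSucc))
      (integrable_bilin (hi i) (hi i) (P' i.castSucc)), Finset.sum_add_distrib]
  ring

omit hw hv [IsProbabilityMeasure μ] in
theorem energy_smul (k : ℕ) (c : ℝ) (P : Fin (d + 1) → Matrix (Fin n) (Fin n) ℝ) :
    S.energy μ w x0 v k (c • P) = c * S.energy μ w x0 v k P := by
  simp only [energy, Pi.smul_apply, Matrix.smul_mulVec, dotProduct_smul, smul_eq_mul,
    integral_const_mul, ← Finset.mul_sum, mul_add]

theorem energy_nonneg (k : ℕ) {P : Fin (d + 1) → Matrix (Fin n) (Fin n) ℝ} (h : 0 ≤ P) :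
    0 ≤ S.energy μ w x0 v k P := by
  have := energy_mono (S := S) (x0 := x0) hw hv k h
  rwa [show (0 : Fin (d + 1) → Matrix (Fin n) (Fin n) ℝ) = (0 : ℝ) • 0 by simp, energy_smul,
    zero_mul] at this

/-- The energy is linear in `P` on a finite-dimensional space, hence continuous. -/
theorem tendsto_energy_zero (k : ℕ) {P : ℕ → Fin (d + 1) → Matrix (Fin n) (Fin n) ℝ}
    (h : Tendsto P atTop (𝓝 0)) :
    Tendsto (fun j => S.energy μ w x0 v k (P j)) atTop (𝓝 0) := by
  let E : (Fin (d + 1) → Matrix (Fin n) (Fin n) ℝ) →ₗ[ℝ] ℝ :=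
    { toFun := S.energy μ w x0 v k
      map_add' := energy_add hw hv k
      map_smul' := energy_smul k }
  have := (E.continuous_of_finiteDimensional.tendsto 0).comp h
  rwa [map_zero] at this

theorem energy_feedback (hd : 0 < d) {K : Matrix (Fin m) (Fin n) ℝ} {s : ℕ}
    (hfb : ∀ k, s ≤ k → v k =ᵐ[μ] fun ω => -(K *ᵥ S.pred μ w x0 v k d ω)) (j : ℕ)
    (P : Fin (d + 1) → Matrix (Fin n) (Fin n) ℝ) :
    S.energy μ w x0 v (s + j) P = S.energy μ w x0 v s ((S.lyapOp d K ^ j) P) := by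
  induction j generalizing P with
  | zero => simp
  | succ j ih =>
    rw [← add_assoc, energy_succ_feedback hw hv hd (hfb _ (Nat.le_add_right s j)), ih, pow_succ,
      Module.End.mul_apply]

omit hv in
theorem pred_at_zero (i : ℕ) : S.pred μ w x0 v 0 i = fun _ => x0 :=
  condExp_const (hw.past_le _) x0

omit hv in
theorem energy_at_zero (P : Fin (d + 1) → Matrix (Fin n) (Fin n) ℝ) :
    S.energy μ w x0 v 0 P = x0 ⬝ᵥ P (Fin.last d) *ᵥ x0 := by
  simp [energy, innov, pred_at_zero hw]

theorem energy_at_one (hd : 0 < d) {v0 : Fin m → ℝ} (hv0 : v 0 = fun _ => v0)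
    (P : Fin (d + 1) → Matrix (Fin n) (Fin n) ℝ) :
    S.energy μ w x0 v 1 P =
      (S.A *ᵥ x0 + S.B *ᵥ v0) ⬝ᵥ P (Fin.last d) *ᵥ (S.A *ᵥ x0 + S.B *ᵥ v0) +
      (S.Abar *ᵥ x0 + S.Bbar *ᵥ v0) ⬝ᵥ P 0 *ᵥ (S.Abar *ᵥ x0 + S.Bbar *ᵥ v0) := by
  rw [energy_succ hw hv hd]
  simp [innov, pred_at_zero hw, hv0]

theorem lintegral_state_eq (k : ℕ) :
    ∫⁻ ω, ENNReal.ofReal (S.state w x0 v k ω ⬝ᵥ S.state w x0 v k ω) ∂μ =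
      ENNReal.ofReal (S.energy (d := d) μ w x0 v k fun _ => 1) := by
  have hx := (state_sqAdapted' (S := S) (x0 := x0) hw hv k).memLp
  have hi := integrable_bilin hx hx 1
  rw [energy_const hw hv]
  simp only [Matrix.one_mulVec] at hi ⊢
  exact (ofReal_integral_eq_lintegral_ofReal hi (Eventually.of_forall fun ω =>
    Finset.sum_nonneg fun i _ => mul_self_nonneg _)).symm

theorem meanSquareStable_iff :
    MeanSquareStable μ (S.state w x0 v) ↔
      Tendsto (fun k => S.energy (d := d) μ w x0 v k fun _ => 1) atTop (𝓝 0) := by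
  simp only [MeanSquareStable, lintegral_state_eq hw hv]
  constructor
  · intro h
    have := (ENNReal.tendsto_toReal ENNReal.zero_ne_top).comp h
    simpa [Function.comp_def, ENNReal.toReal_ofReal
      (energy_nonneg hw hv _ (family_nonneg fun _ => Matrix.PosDef.one))] using this
  · intro h
    simpa using ENNReal.tendsto_ofReal h

end Energy

section ClosedLoop

variable (S)

omit [IsProbabilityMeasure μ] in
theorem closedLoop_eq_state (K : Matrix (Fin m) (Fin n) ℝ) (u0 : Fin d → Fin m → ℝ) :
    S.closedLoop μ w K x0 u0 = S.state w x0 (S.closedLoopInput μ w K x0 u0) := by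
  funext k
  induction k with
  | zero => rfl
  | succ k ih =>
    funext ω
    rw [closedLoop, state, ← ih]
    rfl

omit [IsProbabilityMeasure μ] in
theorem closedLoopInput_initial (K : Matrix (Fin m) (Fin n) ℝ) (u0 : Fin d → Fin m → ℝ) {k : ℕ}
    (hk : k < d) : S.closedLoopInput μ w K x0 u0 k = fun _ => u0 ⟨k, hk⟩ := by
  funext ω
  simp [closedLoopInput, predictorInput, hk]

omit [IsProbabilityMeasure μ] in
theorem closedLoopInput_feedback (K : Matrix (Fin m) (Fin n) ℝ) (u0 : Fin d → Fin m → ℝ) {k : ℕ}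
    (hk : d ≤ k) : S.closedLoopInput μ w K x0 u0 k =
      fun ω => -(K *ᵥ S.pred μ w x0 (S.closedLoopInput μ w K x0 u0) k d ω) := by
  funext ω
  rw [pred, ← closedLoop_eq_state]
  simp [closedLoopInput, predictorInput, hk.not_gt]

variable {S}

/-- Strong induction is needed because the input at `k` is a predictor of `x_k`, which depends on
all inputs before `k`. -/
theorem closedLoopInput_sqAdapted (hw : IsWhiteNoise μ w) (K : Matrix (Fin m) (Fin n) ℝ)
    (u0 : Fin d → Fin m → ℝ) (k : ℕ) :
    SqAdapted μ (pastSigma w (k - d)) (S.closedLoopInput μ w K x0 u0 k) := by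
  induction k using Nat.strong_induction_on with
  | _ k ih =>
    by_cases hk : k < d
    · rw [closedLoopInput_initial S K u0 hk]
      exact SqAdapted.const _
    · rw [closedLoopInput_feedback S K u0 (not_lt.1 hk)]
      exact ((SqAdapted.condExp (state_sqAdapted hw ih k le_rfl).memLp).mulVec K).neg

theorem isStabilizing_of_contracting (hd : 0 < d) (hw : IsWhiteNoise μ w)
    {K : Matrix (Fin m) (Fin n) ℝ} (hK : Contracting (S.lyapOp d K)) :
    S.IsStabilizing d μ w K := by
  intro x0 u0
  have hv := closedLoopInput_sqAdapted (S := S) (x0 := x0) hw K u0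
  rw [closedLoop_eq_state, meanSquareStable_iff hw hv, ← tendsto_add_atTop_iff_nat d]
  refine (tendsto_energy_zero (S := S) (x0 := x0) hw hv d (hK fun _ => 1)).congr fun j => ?_
  rw [add_comm j d, energy_feedback hw hv hd fun k hk =>
    Eventually.of_forall fun ω => congrFun (closedLoopInput_feedback S K u0 hk) ω]

/-- The initial inputs by which predictor feedback already acts from time `1`, after the input
`v0` at time `0`. -/
def startInput (S : NoisySystem n m) (d : ℕ) (K : Matrix (Fin m) (Fin n) ℝ) (x0 : Fin n → ℝ)
    (v0 : Fin m → ℝ) (k : Fin d) : Fin m → ℝ :=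
  if (k : ℕ) = 0 then v0
  else -(K *ᵥ ((S.A - S.B * K) ^ ((k : ℕ) - 1) *ᵥ (S.A *ᵥ x0 + S.B *ᵥ v0)))

/-- For `k < d` the predictor conditions on the trivial σ-algebra and is deterministic, so feedback
can be encoded in the initial inputs. -/
theorem closedLoop_startInput_feedback (hd : 0 < d) (hw : IsWhiteNoise μ w)
    (K : Matrix (Fin m) (Fin n) ℝ) (v0 : Fin m → ℝ) (k : ℕ) (hk : 1 ≤ k) :
    S.closedLoopInput μ w K x0 (S.startInput d K x0 v0) k =ᵐ[μ] fun ω =>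
      -(K *ᵥ S.pred μ w x0 (S.closedLoopInput μ w K x0 (S.startInput d K x0 v0)) k d ω) := by
  set v := S.closedLoopInput μ w K x0 (S.startInput d K x0 v0) with hvdef
  have hv : ∀ k, SqAdapted μ (pastSigma w (k - d)) (v k) := closedLoopInput_sqAdapted hw K _
  have hpred : ∀ j, j + 1 ≤ d → S.pred μ w x0 v (j + 1) d =ᵐ[μ] fun _ =>
      (S.A - S.B * K) ^ j *ᵥ (S.A *ᵥ x0 + S.B *ᵥ v0) := by
    intro j
    induction j with
    | zero =>
      intro _
      have h := pred_succ_succ (S := S) (x0 := x0) hw hv 0 (Nat.sub_le d 1)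
      rw [Nat.sub_add_cancel hd] at h
      filter_upwards [h] with ω h
      rw [h, pred_at_zero hw, hvdef, closedLoopInput_initial S K _ hd]
      simp [startInput]
    | succ j ih =>
      intro hj
      have h := pred_succ_succ (S := S) (x0 := x0) hw hv (j + 1) (Nat.sub_le d 1)
      rw [Nat.sub_add_cancel hd] at h
      -- Both truncated differences are 0 here, so both predictors condition on the trivial
      -- σ-algebra.
      have heq : S.pred μ w x0 v (j + 1) (d - 1) = S.pred μ w x0 v (j + 1) d := by
        rw [pred, pred, show j + 1 - (d - 1) = j + 1 - d by omega]
      filter_upwards [h, ih (by omega)] with ω h h'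
      rw [h, heq, h', hvdef, closedLoopInput_initial S K _ (show j + 1 < d by omega)]
      simp only [startInput, Nat.add_eq_zero_iff, one_ne_zero, and_false, if_false,
        Nat.add_sub_cancel, Matrix.mulVec_neg, pow_succ', ← Matrix.mulVec_mulVec, Matrix.sub_mulVec]
      abel
  by_cases hkd : d ≤ k
  · exact Eventually.of_forall fun ω => congrFun (closedLoopInput_feedback S K _ hkd) ω
  · obtain ⟨j, rfl⟩ : ∃ j, k = j + 1 := ⟨k - 1, by omega⟩
    filter_upwards [hpred j (by omega)] with ω h
    rw [h, hvdef, closedLoopInput_initial S K _ (not_le.1 hkd)]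
    simp [startInput]

/-- With feedback from time 1 on, the second moment at time `j + 1` is a form in the `j`-th iterate
of the identity family, with `x0` and `v0` free. The choice `v0 = 0` controls component 0 on the
range of `Abar`, and `v0 = -K x0` controls the last component; the recursion then descends to the
others. -/
theorem contracting_of_isStabilizing (hd : 0 < d) (hw : IsWhiteNoise μ w)
    {K : Matrix (Fin m) (Fin n) ℝ} (hK : S.IsStabilizing d μ w K) :
    Contracting (S.lyapOp d K) := by
  set P : ℕ → Fin (d + 1) → Matrix (Fin n) (Fin n) ℝ := fun j => (S.lyapOp d K ^ j) fun _ => 1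
    with hP
  have hnonneg : ∀ j, 0 ≤ P j := fun j =>
    congrOp_pow_nonneg j (family_nonneg fun _ => Matrix.PosDef.one)
  have hpsd : ∀ j i, (P j i).PosSemidef := fun j i => Matrix.nonneg_iff_posSemidef.1 (hnonneg j i)
  have hsucc : ∀ j, P (j + 1) = S.lyapOp d K (P j) := fun j => by
    simp only [hP, pow_succ', Module.End.mul_apply]
  have hlim : ∀ x0 v0, Tendsto (fun j =>
      (S.A *ᵥ x0 + S.B *ᵥ v0) ⬝ᵥ P j (Fin.last d) *ᵥ (S.A *ᵥ x0 + S.B *ᵥ v0) +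
      (S.Abar *ᵥ x0 + S.Bbar *ᵥ v0) ⬝ᵥ P j 0 *ᵥ (S.Abar *ᵥ x0 + S.Bbar *ᵥ v0)) atTop (𝓝 0) := by
    intro x0 v0
    have hv := closedLoopInput_sqAdapted (S := S) (x0 := x0) hw K (S.startInput d K x0 v0)
    have h := hK x0 (S.startInput d K x0 v0)
    rw [closedLoop_eq_state, meanSquareStable_iff hw hv, ← tendsto_add_atTop_iff_nat 1] at h
    refine h.congr fun j => ?_
    rw [add_comm j 1, energy_feedback hw hv hd (closedLoop_startInput_feedback hd hw K v0),
      energy_at_one hw hv hd (v0 := v0)]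
    rw [closedLoopInput_initial S K _ hd]
    simp [startInput]
  have hbar : ∀ x, Tendsto (fun j => (S.Abar *ᵥ x) ⬝ᵥ P j 0 *ᵥ (S.Abar *ᵥ x)) atTop (𝓝 0) :=
    fun x => by
      have h := hlim x 0
      simp only [Matrix.mulVec_zero, add_zero] at h
      exact squeeze_zero (fun j => (hpsd j 0).quadForm_nonneg _)
        (fun j => le_add_of_nonneg_left ((hpsd j _).quadForm_nonneg _)) h
  have hquad : ∀ i x, Tendsto (fun j => x ⬝ᵥ P j i *ᵥ x) atTop (𝓝 0) := by
    intro i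
    induction i using Fin.reverseInduction with
    | last =>
      intro x
      rw [← tendsto_add_atTop_iff_nat 1]
      refine (hlim x (-(K *ᵥ x))).congr fun j => ?_
      have hsub : ∀ (M : Matrix (Fin n) (Fin n) ℝ) (N : Matrix (Fin n) (Fin m) ℝ),
          M *ᵥ x + N *ᵥ (-(K *ᵥ x)) = (M - N * K) *ᵥ x := fun M N => by
        rw [Matrix.sub_mulVec, Matrix.mulVec_neg, Matrix.mulVec_mulVec, sub_eq_add_neg]
      rw [hsucc, lyapOp_last, Matrix.add_mulVec, dotProduct_add, Matrix.quadForm_congr_mul,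
        Matrix.quadForm_congr_mul, hsub, hsub]
    | cast i ih =>
      intro x
      rw [← tendsto_add_atTop_iff_nat 1]
      have := (ih (S.A *ᵥ x)).add (hbar x)
      rw [add_zero] at this
      refine this.congr fun j => ?_
      rw [hsucc, lyapOp_castSucc, Matrix.add_mulVec, dotProduct_add, Matrix.quadForm_congr_mul,
        Matrix.quadForm_congr_mul]
  exact contracting_of_posDef (fun _ => Matrix.PosDef.one) <| tendsto_pi_nhds.2 fun i =>
    Matrix.tendsto_zero_of_quadForm (fun j => (hpsd j i).transpose_eq) (hquad i)

end ClosedLoop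

theorem gramObservable_of_exactlyObservable (hw : IsWhiteNoise μ w)
    {Q : Matrix (Fin n) (Fin n) ℝ} (hQ : Q.PosSemidef) (h : S.ExactlyObservable μ w Q) :
    S.GramObservable Q := by
  intro x0 hx0
  refine h x0 fun k => ?_
  -- The zero input is adapted for any delay. Delay 1 with gain 0 makes the energy identities
  -- available for the uncontrolled system.
  have hv : ∀ k, SqAdapted μ (pastSigma w (k - 1))
      ((fun _ _ => 0 : ℕ → Ω → Fin m → ℝ) k) := fun k => SqAdapted.const 0
  have hop : ∀ k, (S.lyapOp 1 0 ^ k) (fun _ => Q) = fun _ => S.obsGram Q k := fun k => by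
    induction k with
    | zero => rfl
    | succ k ih =>
      rw [pow_succ', Module.End.mul_apply, ih]
      funext i
      refine Fin.lastCases ?_ (fun i => ?_) i
      · rw [lyapOp_last]; simp [obsGram]
      · rw [lyapOp_castSucc]; simp [obsGram]
  have hE := energy_feedback (S := S) (x0 := x0) hw hv one_pos (K := 0) (s := 0)
    (fun k _ => Eventually.of_forall fun ω => by simp) k fun _ => Q
  rw [hop, zero_add, energy_const hw hv, energy_at_zero hw, hx0 k] at hE
  have hx := (state_sqAdapted' (S := S) (x0 := x0) hw hv k).memLp
  have hae := (integral_eq_zero_iff_of_nonneg (fun ω => hQ.quadForm_nonneg _)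
    (integrable_bilin hx hx Q)).1 hE
  filter_upwards [hae] with ω hω
  have hQ0 : 0 ≤ Q := Matrix.nonneg_iff_posSemidef.2 hQ
  have hs := (Matrix.nonneg_iff_posSemidef.1 (CFC.sqrt_nonneg Q)).transpose_eq
  have hsq : (CFC.sqrt Q)ᵀ * 1 * CFC.sqrt Q = Q := by
    rw [hs, Matrix.mul_one, CFC.sqrt_mul_sqrt_self Q hQ0]
  have hω' : S.state w x0 (fun _ _ => 0) k ω ⬝ᵥ Q *ᵥ S.state w x0 (fun _ _ => 0) k ω = 0 := hω
  rw [← hsq, Matrix.quadForm_congr_mul, Matrix.one_mulVec] at hω'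
  exact dotProduct_self_eq_zero.1 hω'

end NoisySystem

/-! ### Optimality of the Riccati gain -/

namespace NoisySystem

variable {n m d : ℕ} {Ω : Type*} {S : NoisySystem n m} [m0 : MeasurableSpace Ω]
  {μ : Measure Ω} [IsProbabilityMeasure μ] {w : ℕ → Ω → ℝ} {x0 : Fin n → ℝ}
  {Q : Matrix (Fin n) (Fin n) ℝ} {R : Matrix (Fin m) (Fin m) ℝ}
  {K : Matrix (Fin m) (Fin n) ℝ} {P : Fin (d + 1) → Matrix (Fin n) (Fin n) ℝ}

/-- The expected running cost at time `k`. -/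
noncomputable def stageCost (S : NoisySystem n m) (μ : Measure Ω) (w : ℕ → Ω → ℝ)
    (Q : Matrix (Fin n) (Fin n) ℝ) (R : Matrix (Fin m) (Fin m) ℝ) (x0 : Fin n → ℝ)
    (v : ℕ → Ω → Fin m → ℝ) (k : ℕ) : ℝ :=
  ∫ ω, (S.state w x0 v k ω ⬝ᵥ Q *ᵥ S.state w x0 v k ω + v k ω ⬝ᵥ R *ᵥ v k ω) ∂μ

/-- The expected loss at time `k` from deviating from predictor feedback with gain `K`. -/
noncomputable def deviationCost (S : NoisySystem n m) (d : ℕ) (μ : Measure Ω) (w : ℕ → Ω → ℝ)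
    (W : Matrix (Fin m) (Fin m) ℝ) (K : Matrix (Fin m) (Fin n) ℝ) (x0 : Fin n → ℝ)
    (v : ℕ → Ω → Fin m → ℝ) (k : ℕ) : ℝ :=
  ∫ ω, (v k ω + K *ᵥ S.pred μ w x0 v k d ω) ⬝ᵥ W *ᵥ (v k ω + K *ᵥ S.pred μ w x0 v k d ω) ∂μ

section Adapted

variable {v : ℕ → Ω → Fin m → ℝ}

/-- One-step dissipation identity: the Riccati equations balance the innovations exactly, and
completing the square at the predictor leaves the deviation cost. -/
theorem stageCost_add_energy (hd : 0 < d) (hw : IsWhiteNoise μ w)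
    (hv : ∀ k, SqAdapted μ (pastSigma w (k - d)) (v k)) (hR : R.PosDef)
    (h : S.IsRiccatiSolution Q R K P) (k : ℕ) :
    S.stageCost μ w Q R x0 v k + S.energy μ w x0 v (k + 1) P =
      S.energy μ w x0 v k P + S.deviationCost d μ w (S.gainWeight R P) K x0 v k := by
  have hx := (state_sqAdapted' (S := S) (x0 := x0) hw hv k).memLp
  have hp := (pred_sqAdapted (S := S) (x0 := x0) hw hv k d).memLp
  have hvk := (hv k).memLp
  have hmem : ∀ (M : Matrix (Fin n) (Fin n) ℝ) (N : Matrix (Fin n) (Fin m) ℝ),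
      MemLp (fun ω => M *ᵥ S.pred μ w x0 v k d ω + N *ᵥ v k ω) 2 μ := fun M N =>
    (hp.mulVec M).add (hvk.mulVec N)
  have hdev : MemLp (fun ω => v k ω + K *ᵥ S.pred μ w x0 v k d ω) 2 μ := hvk.add (hp.mulVec K)
  have hsq : ∀ ω, _ := fun ω => quadForm_complete_square (S := S) hR (family_nonneg h.posDef)
    (S.pred μ w x0 v k d ω) (v k ω)
  rw [← h.gain_eq] at hsq
  have hint := integral_congr_ae (μ := μ) (Eventually.of_forall hsq)
  have i1 := integrable_bilin (hmem S.A S.B) (hmem S.A S.B) (P (Fin.last d))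
  have i2 := integrable_bilin (hmem S.Abar S.Bbar) (hmem S.Abar S.Bbar) (P 0)
  have i12 : Integrable (fun ω =>
      (S.A *ᵥ S.pred μ w x0 v k d ω + S.B *ᵥ v k ω) ⬝ᵥ
        P (Fin.last d) *ᵥ (S.A *ᵥ S.pred μ w x0 v k d ω + S.B *ᵥ v k ω) +
      (S.Abar *ᵥ S.pred μ w x0 v k d ω + S.Bbar *ᵥ v k ω) ⬝ᵥ
        P 0 *ᵥ (S.Abar *ᵥ S.pred μ w x0 v k d ω + S.Bbar *ᵥ v k ω)) μ := i1.add i2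
  rw [integral_add i12 (integrable_bilin hvk hvk _), integral_add i1 i2,
    integral_add (integrable_bilin hp hp _) (integrable_bilin hdev hdev _)] at hint
  have hstage : S.stageCost μ w Q R x0 v k =
      S.energy (d := d) μ w x0 v k (fun _ => Q) + ∫ ω, v k ω ⬝ᵥ R *ᵥ v k ω ∂μ := by
    rw [energy_const hw hv, stageCost, integral_add (integrable_bilin hx hx _)
      (integrable_bilin hvk hvk _)]
  -- The constant family `Q` is split off because its energy is exactly `E[x_k' Q x_k]`.
  have hP : P = (fun i => Fin.lastCases (S.lyapOp d K P (Fin.last d) + Kᵀ * R * K)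
      (fun i => S.Aᵀ * P i.succ * S.A + S.Abarᵀ * P 0 * S.Abar) i) + fun _ => Q := by
    funext i
    refine Fin.lastCases ?_ (fun i => ?_) i
    · simpa [lyapOp_last] using h.lyapunov.2
    · simpa using h.lyapunov.1 i
  have henergy := congrArg (S.energy μ w x0 v k) hP
  rw [energy_add hw hv] at henergy
  conv at henergy => rhs; lhs; rw [energy]
  simp only [Fin.lastCases_last, Fin.lastCases_castSucc] at henergy
  rw [hstage, henergy, energy_succ hw hv hd, deviationCost]
  linarith

theorem sum_stageCost (hd : 0 < d) (hw : IsWhiteNoise μ w)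
    (hv : ∀ k, SqAdapted μ (pastSigma w (k - d)) (v k)) (hR : R.PosDef)
    (h : S.IsRiccatiSolution Q R K P) (N : ℕ) :
    ∑ k ∈ Finset.range N, S.stageCost μ w Q R x0 v k + S.energy μ w x0 v N P =
      x0 ⬝ᵥ P (Fin.last d) *ᵥ x0 +
      ∑ k ∈ Finset.range N, S.deviationCost d μ w (S.gainWeight R P) K x0 v k := by
  induction N with
  | zero => simp [energy_at_zero hw]
  | succ N ih =>
    rw [Finset.sum_range_succ, Finset.sum_range_succ]
    linarith [stageCost_add_energy (x0 := x0) hd hw hv hR h N]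

omit [IsProbabilityMeasure μ] in
theorem stageCost_nonneg (hQ : Q.PosSemidef) (hR : R.PosDef) (k : ℕ) :
    0 ≤ S.stageCost μ w Q R x0 v k :=
  integral_nonneg fun _ => add_nonneg (hQ.quadForm_nonneg _) (hR.posSemidef.quadForm_nonneg _)

omit [IsProbabilityMeasure μ] in
theorem deviationCost_nonneg {W : Matrix (Fin m) (Fin m) ℝ} (hW : W.PosDef) (k : ℕ) :
    0 ≤ S.deviationCost d μ w W K x0 v k :=
  integral_nonneg fun _ => hW.posSemidef.quadForm_nonneg _

theorem cost_eq_tsum (hw : IsWhiteNoise μ w)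
    (hv : ∀ k, SqAdapted μ (pastSigma w (k - d)) (v k)) (hQ : Q.PosSemidef) (hR : R.PosDef) :
    cost μ Q R (S.state w x0 v) v = ∑' k, ENNReal.ofReal (S.stageCost μ w Q R x0 v k) := by
  have hi : ∀ k, Integrable (fun ω => S.state w x0 v k ω ⬝ᵥ Q *ᵥ S.state w x0 v k ω +
      v k ω ⬝ᵥ R *ᵥ v k ω) μ := fun k =>
    (integrable_bilin (state_sqAdapted' hw hv k).memLp (state_sqAdapted' hw hv k).memLp Q).add
      (integrable_bilin (hv k).memLp (hv k).memLp R)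
  rw [cost, lintegral_tsum fun k => (hi k).aestronglyMeasurable.aemeasurable.ennreal_ofReal]
  refine tsum_congr fun k => ?_
  rw [stageCost, ofReal_integral_eq_lintegral_ofReal (hi k) (Eventually.of_forall fun ω =>
    add_nonneg (hQ.quadForm_nonneg _) (hR.posSemidef.quadForm_nonneg _))]

/-- An adapted input of finite cost is square-integrable. -/
theorem IsAdmissible.sqAdapted (hw : IsWhiteNoise μ w) {u0 : Fin d → Fin m → ℝ}
    (h : S.IsAdmissible μ w x0 u0 v) (hQ : Q.PosSemidef) (hR : R.PosDef)
    (hfin : cost μ Q R (S.state w x0 v) v ≠ ⊤) (k : ℕ) :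
    SqAdapted μ (pastSigma w (k - d)) (v k) := by
  by_cases hk : k < d
  · rw [show v k = _ from h.initial ⟨k, hk⟩]
    exact SqAdapted.const _
  have hmeas := h.adapted k (not_lt.1 hk)
  have hmeas0 := hmeas.mono (hw.past_le _)
  refine ⟨hmeas, (memLp_two_iff_integrable_sq_norm hmeas0).2 ⟨hmeas0.norm.pow 2, ?_⟩⟩
  obtain ⟨ε, hε, hle⟩ := hR.exists_smul_le 1 Matrix.transpose_one
  have hle := Matrix.le_iff.1 (hle ε hε.le le_rfl)
  have hbound : ∀ y : Fin m → ℝ, ‖y‖ ^ 2 ≤ ε⁻¹ * (y ⬝ᵥ R *ᵥ y) := fun y => by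
    have h1 := hle.quadForm_nonneg y
    rw [Matrix.sub_mulVec, dotProduct_sub, Matrix.smul_mulVec, dotProduct_smul,
      Matrix.one_mulVec, smul_eq_mul] at h1
    have h2 : ‖y‖ ^ 2 ≤ y ⬝ᵥ y := by
      have hyy : 0 ≤ y ⬝ᵥ y := Finset.sum_nonneg fun i _ => mul_self_nonneg _
      rw [← Real.le_sqrt (norm_nonneg y) hyy, pi_norm_le_iff_of_nonneg (Real.sqrt_nonneg _)]
      refine fun i => Real.le_sqrt_of_sq_le ?_
      rw [Real.norm_eq_abs, sq_abs, sq]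
      exact Finset.single_le_sum (f := fun i => y i * y i) (fun i _ => mul_self_nonneg _)
        (Finset.mem_univ i)
    rw [inv_mul_eq_div, le_div_iff₀ hε]
    nlinarith
  refine lt_of_le_of_lt ?_ (ENNReal.mul_lt_top (ENNReal.ofReal_lt_top (r := ε⁻¹)) hfin.lt_top)
  rw [cost, ← lintegral_const_mul' _ _ ENNReal.ofReal_ne_top]
  refine lintegral_mono fun ω => ?_
  rw [Real.enorm_of_nonneg (by positivity)]
  refine le_trans ?_ (mul_le_mul_right (ENNReal.le_tsum k) _)
  rw [← ENNReal.ofReal_mul (by positivity)]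
  refine ENNReal.ofReal_le_ofReal ((hbound _).trans ?_)
  exact mul_le_mul_of_nonneg_left (le_add_of_nonneg_left (hQ.quadForm_nonneg _)) (by positivity)

omit [IsProbabilityMeasure μ] in
theorem IsAdmissible.state_eq {u0 : Fin d → Fin m → ℝ} (h : S.IsAdmissible μ w x0 u0 v) (k : ℕ)
    (hk : k ≤ d) : S.state w x0 v k = S.state w x0 (S.closedLoopInput μ w K x0 u0) k := by
  induction k with
  | zero => rfl
  | succ k ih =>
    rw [state_succ, state_succ, ih (by omega), closedLoopInput_initial S K u0 hk,
      show v k = _ from h.initial ⟨k, hk⟩]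

omit [IsProbabilityMeasure μ] in
theorem IsAdmissible.deviationCost_eq {u0 : Fin d → Fin m → ℝ} (h : S.IsAdmissible μ w x0 u0 v)
    (W : Matrix (Fin m) (Fin m) ℝ) {k : ℕ} (hk : k < d) :
    S.deviationCost d μ w W K x0 v k =
      S.deviationCost d μ w W K x0 (S.closedLoopInput μ w K x0 u0) k := by
  rw [deviationCost, deviationCost, pred, pred, h.state_eq (K := K) k hk.le,
    closedLoopInput_initial S K u0 hk, show v k = _ from h.initial ⟨k, hk⟩]

end Adapted

theorem IsRiccatiSolution.isOptimalGain (hd : 0 < d) (hw : IsWhiteNoise μ w) (hQ : Q.PosSemidef)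
    (hR : R.PosDef) (hobs : S.GramObservable Q) (h : S.IsRiccatiSolution Q R K P) :
    S.IsOptimalGain d μ w Q R K := by
  refine ⟨isStabilizing_of_contracting hd hw (h.contracting hobs hQ hR), fun x0 u0 => ?_⟩
  set vK := S.closedLoopInput μ w K x0 u0 with hvK
  have hvs : ∀ k, SqAdapted μ (pastSigma w (k - d)) (vK k) := closedLoopInput_sqAdapted hw K u0
  have hP := family_nonneg h.posDef
  have hW := gainWeight_posDef (S := S) hR hP
  set dev := S.deviationCost d μ w (S.gainWeight R P) K x0 with hdevdef
  -- The optimal value. The first `d` deviation costs are common to all admissible inputs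
  -- (`IsAdmissible.deviationCost_eq`).
  set J := x0 ⬝ᵥ P (Fin.last d) *ᵥ x0 + ∑ k ∈ Finset.range d, dev vK k with hJ
  have hdev0 : ∀ k, d ≤ k → dev vK k = 0 := fun k hk => by
    refine integral_eq_zero_of_ae (Eventually.of_forall fun ω => ?_)
    have := congrFun (closedLoopInput_feedback (μ := μ) (w := w) (x0 := x0) S K u0 hk) ω
    rw [← hvK] at this
    simp [this]
  have hle : cost μ Q R (S.closedLoop μ w K x0 u0) vK ≤ ENNReal.ofReal J := by
    rw [closedLoop_eq_state, cost_eq_tsum hw hvs hQ hR]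
    refine ENNReal.tsum_le_of_sum_range_le fun N => ?_
    rw [← ENNReal.ofReal_sum_of_nonneg fun k _ => stageCost_nonneg hQ hR k]
    refine ENNReal.ofReal_le_ofReal ?_
    have hsum := sum_stageCost (x0 := x0) hd hw hvs hR h N
    have hE := energy_nonneg (S := S) (x0 := x0) hw hvs N hP
    have hmono : ∑ k ∈ Finset.range N, dev vK k ≤ ∑ k ∈ Finset.range d, dev vK k := by
      refine (Finset.sum_le_sum_of_subset_of_nonneg (Finset.range_mono (Nat.le_add_right N d))
        fun k _ _ => deviationCost_nonneg hW k).trans_eq ?_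
      exact (Finset.sum_subset (Finset.range_mono (Nat.le_add_left d N)) fun k _ hk =>
        hdev0 k (by simpa using hk)).symm
    linarith
  refine ⟨ne_top_of_le_ne_top ENNReal.ofReal_ne_top hle, fun v hadm => hle.trans ?_⟩
  -- Admissibility does not include square-integrability of the input; finite cost supplies it
  -- through `R > 0`.
  by_cases hfin : cost μ Q R (S.state w x0 v) v = ⊤
  · rw [hfin]; exact le_top
  have hv := hadm.sqAdapted hw hQ hR hfin
  obtain ⟨ε, hε, hεle⟩ := exists_smul_le_family (P := fun _ : Fin (d + 1) =>
    (1 : Matrix (Fin n) (Fin n) ℝ)) (fun _ => Matrix.PosDef.one)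
    fun i => (h.posDef i).posSemidef.transpose_eq
  -- Since `ε • P ≤ 1`, the energy is at most `ε⁻¹ E[x_N' x_N]`, which vanishes by stability.
  have hE : Tendsto (fun N => S.energy μ w x0 v N P) atTop (𝓝 0) := by
    have h1 := ((meanSquareStable_iff hw hv).1 hadm.stable).const_mul ε⁻¹
    rw [mul_zero] at h1
    refine squeeze_zero (fun N => energy_nonneg hw hv N hP) (fun N => ?_) h1
    have h2 := energy_mono (S := S) (x0 := x0) hw hv N hεle
    rw [energy_smul] at h2
    rwa [← div_eq_inv_mul, le_div_iff₀ hε, mul_comm]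
  have hlim : Tendsto (fun N => ENNReal.ofReal (J - S.energy μ w x0 v N P)) atTop
      (𝓝 (ENNReal.ofReal J)) := by
    have := ENNReal.tendsto_ofReal (hE.const_sub J)
    rwa [sub_zero] at this
  refine le_of_tendsto hlim ?_
  filter_upwards [eventually_ge_atTop d] with N hN
  rw [cost_eq_tsum hw hv hQ hR]
  refine le_trans ?_ (ENNReal.sum_le_tsum (Finset.range N))
  rw [← ENNReal.ofReal_sum_of_nonneg fun k _ => stageCost_nonneg hQ hR k]
  refine ENNReal.ofReal_le_ofReal ?_
  have hsum := sum_stageCost (x0 := x0) hd hw hv hR h N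
  have hdev : ∑ k ∈ Finset.range d, dev vK k ≤ ∑ k ∈ Finset.range N, dev v k := by
    rw [Finset.sum_congr rfl fun k hk => (hadm.deviationCost_eq (K := K) (S.gainWeight R P)
      (Finset.mem_range.1 hk)).symm]
    exact Finset.sum_le_sum_of_subset_of_nonneg (Finset.range_mono hN)
      fun k _ _ => deviationCost_nonneg hW k
  linarith

end NoisySystem

theorem theorem1 {n m d : ℕ} (hd : 0 < d) {Ω : Type*} [MeasurableSpace Ω]
    (μ : Measure Ω) [IsProbabilityMeasure μ] (w : ℕ → Ω → ℝ) (hw : IsWhiteNoise μ w)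
    (S : NoisySystem n m) (Q : Matrix (Fin n) (Fin n) ℝ) (R : Matrix (Fin m) (Fin m) ℝ)
    (hQ : Q.PosSemidef) (hR : R.PosDef) (hobs : S.ExactlyObservable μ w Q)
    (K0 : Matrix (Fin m) (Fin n) ℝ) (hK0 : S.IsStabilizing d μ w K0) :
    (∃! KP : (ℕ → Matrix (Fin m) (Fin n) ℝ) × (ℕ → Fin (d + 1) → Matrix (Fin n) (Fin n) ℝ),
      S.IsPolicyIteration Q R K0 KP.1 KP.2) ∧
    ∀ (K : ℕ → Matrix (Fin m) (Fin n) ℝ) (P : ℕ → Fin (d + 1) → Matrix (Fin n) (Fin n) ℝ),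
      S.IsPolicyIteration Q R K0 K P →
        (∀ j, S.IsStabilizing d μ w (K j)) ∧
        (∀ j i, (P (j + 1) i).PosDef ∧ (P j i - P (j + 1) i).PosSemidef) ∧
        ∃ (Kopt : Matrix (Fin m) (Fin n) ℝ) (Popt : Fin (d + 1) → Matrix (Fin n) (Fin n) ℝ),
          S.IsRiccatiSolution Q R Kopt Popt ∧
          (∀ (K' : Matrix (Fin m) (Fin n) ℝ) (P' : Fin (d + 1) → Matrix (Fin n) (Fin n) ℝ),
            S.IsRiccatiSolution Q R K' P' → K' = Kopt ∧ P' = Popt) ∧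
          (∀ i, Tendsto (fun j => P j i) atTop (𝓝 (Popt i))) ∧
          Tendsto K atTop (𝓝 Kopt) ∧
          S.IsOptimalGain d μ w Q R Kopt := by
  have hgram := NoisySystem.gramObservable_of_exactlyObservable hw hQ hobs
  have hcontr := NoisySystem.contracting_of_isStabilizing hd hw hK0
  refine ⟨NoisySystem.existsUnique_policyIteration hgram hQ hR hcontr, fun K P h => ⟨fun j =>
    NoisySystem.isStabilizing_of_contracting hd hw (h.contracting hgram hQ hR hcontr j),
    fun j i => ⟨h.posDef _ _, Matrix.le_iff.1 (h.antitone hgram hQ hR hcontr j i)⟩, ?_⟩⟩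
  obtain ⟨Kopt, Popt, hopt, hP, hK⟩ := h.exists_limit hgram hQ hR hcontr
  exact ⟨Kopt, Popt, hopt, fun K' P' h' => h'.unique hgram hQ hR hopt, hP, hK,
    hopt.isOptimalGain hd hw hQ hR hgram⟩
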